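/- Let $(\omega_n)_{n\ge1}$, $(\zeta_n)_{n\ge1}$ be sequences of complex numbers and $(r_n)_{n\ge1}$ a sequence of real numbers, each consisting of pairwise distinct numbers, let $\eta\in\mathbb R$, and suppose that $\omega_n\neq\zeta_m$, $\omega_n\neq\overline{\zeta_m}$, $r_n\neq i\omega_m$, $r_n\neq i\zeta_m$, $r_n\neq-\eta$, $\zeta_n\neq0$ for all $n,m$; suppose moreover that no exponent $i\omega_n$, $i\zeta_n$ coincides with one of the conjugate exponents $-i\overline{\omega_m}$, $-i\overline{\zeta_m}$, that is, $\omega_n\neq-\overline{\omega_m}$, $\zeta_n\neq-\overline{\zeta_m}$ and $\omega_n\neq-\overline{\zeta_m}$ for all $n,m$ (including $n=m$). Let $(c_n)$, $(d_n)$ be complex sequences, and let $\gamma>0$, $\alpha>0$, $\chi<0$, $\mu>0$, $\nu>1/2$, $M>0$ and $n'\in\mathbb N$ be such that $$\liminf_{n\to\infty}(\Re\omega_{n+1}-\Re\omega_n)=\liminf_{n\to\infty}(\Re\zeta_{n+1}-\Re\zeta_n)=\gamma,$$ $$\lim_{n\to\infty}\Im\omega_n=\alpha,\qquad \lim_{n\to\infty}r_n=\chi,\qquad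 \lim_{n\to\infty}\Im\zeta_n=0,$$ $$|d_n|\asymp|\zeta_n|,\qquad |c_n|\le\frac{M}{|\omega_n|}\qquad(n\ge1).$$ Here $F\asymp G$ means that there are constants $c_1,c_2>0$ with $c_1F\le G\le c_2F$. Assume $\gamma>4\alpha$ and $T>\dfrac{2\pi}{\sqrt{\gamma^2-16\alpha^2}}$. Then there are constants $c_1,c_2>0$ such that the following holds for all complex sequences $(C_n)_{n\ge1}$, $(D_n)_{n\ge1}$, all real sequences $(R_n)_{n\ge1}$ and all $\mathcal E\in\mathbb R$ with $$|R_n|\le\frac{\mu}{n^\nu}\big(|C_n|^2+|d_nD_n|^2\big)^{1/2}\ (n\ge n'),\qquad |R_n|\le\mu\big(|C_n|^2+|d_nD_n|^2\big)^{1/2}\ (n\le n'),$$ $$|\mathcal E|^2\le M\sum_{n=1}^\infty\big(|C_n|^2+|d_nD_n|^2\big).$$ If $\sum_n(|C_n|^2+|d_nD_n|^2)<\infty$, then the series $$u_1(t)=\sum_{n=1}^\infty\Big(C_ne^{i\omega_nt}+\overline{C_n}e^{-i\overline{\omega_n}t}+R_ne^{r_nt}+D_ne^{i\zeta_nt}+\overline{D_n}e^{-i\overline{\zeta_n}t}\Big),$$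 $$u_2(t)=\sum_{n=1}^\infty\Big(d_nD_ne^{i\zeta_nt}+\overline{d_nD_n}e^{-i\overline{\zeta_n}t}+c_nC_ne^{i\omega_nt}+\overline{c_nC_n}e^{-i\overline{\omega_n}t}\Big)+\mathcal E e^{-\eta t}$$ converge in $L^2(0,T)$; and whenever these two series converge in $L^2(0,T)$, their sums satisfy $$c_1\int_0^T\big(|u_1(t)|^2+|u_2(t)|^2\big)\,dt\ \le\ \sum_{n=1}^\infty\big(|C_n|^2+|d_nD_n|^2\big)\ \le\ c_2\int_0^T\big(|u_1(t)|^2+|u_2(t)|^2\big)\,dt .$$ -/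

import Mathlib

open MeasureTheory Filter Topology Complex ComplexConjugate

/- Sequences indexed by `n = 1, 2, 3, …` are written as functions on `ℕ`; the value at `n : ℕ`
is the entry with index `n + 1`. -/

/-- `F ≍ G`: there are constants `c₁, c₂ > 0` with `c₁ F ≤ G ≤ c₂ F` (uniformly in the index). -/
def Comparable {ι : Type*} (F G : ι → ℝ) : Prop :=
  ∃ c₁ > 0, ∃ c₂ > 0, ∀ i, c₁ * F i ≤ G i ∧ G i ≤ c₂ * F i

/-- The real-valued function `A e^{iσt} + conj(A) e^{-i conj(σ) t}`. -/
noncomputable def conjPairExp (A σ : ℂ) (t : ℝ) : ℂ :=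
  A * exp (I * σ * t) + conj A * exp (-I * conj σ * t)

/-- The general term of the series defining `u₁`. -/
noncomputable def firstTerm (ω ζ : ℕ → ℂ) (r : ℕ → ℝ) (C D : ℕ → ℂ) (R : ℕ → ℝ)
    (n : ℕ) (t : ℝ) : ℂ :=
  conjPairExp (C n) (ω n) t + (R n : ℂ) * exp ((r n : ℂ) * t) + conjPairExp (D n) (ζ n) t

/-- The general term of the series defining `u₂` (without the term `ℰ e^{-ηt}`). -/
noncomputable def secondTerm (ω ζ : ℕ → ℂ) (c d : ℕ → ℂ) (C D : ℕ → ℂ)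
    (n : ℕ) (t : ℝ) : ℂ :=
  conjPairExp (d n * D n) (ζ n) t + conjPairExp (c n * C n) (ω n) t

/-- `u ∈ L²(0,T)` and the series `∑ f n` converges to `u` in `L²(0,T)`. -/
def IsL2Sum (T : ℝ) (f : ℕ → ℝ → ℂ) (u : ℝ → ℂ) : Prop :=
  MemLp u 2 (volume.restrict (Set.Ioo 0 T)) ∧
    Tendsto (fun N : ℕ => eLpNorm (fun t => (∑ n ∈ Finset.range N, f n t) - u t) 2
      (volume.restrict (Set.Ioo 0 T))) atTop (𝓝 0)

/-- `(u₁, u₂)` is, in `L²(0,T)`, the pair of functions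
`u₁ = ∑ (C_n e^{iω_n t} + conj + R_n e^{r_n t} + D_n e^{iζ_n t} + conj)`,
`u₂ = ∑ (d_n D_n e^{iζ_n t} + conj + c_n C_n e^{iω_n t} + conj) + ℰ e^{-ηt}`. -/
def IsSeriesPair (T η : ℝ) (ω ζ : ℕ → ℂ) (r : ℕ → ℝ) (c d : ℕ → ℂ)
    (C D : ℕ → ℂ) (R : ℕ → ℝ) (E : ℝ) (u₁ u₂ : ℝ → ℂ) : Prop :=
  IsL2Sum T (firstTerm ω ζ r C D R) u₁ ∧
    IsL2Sum T (secondTerm ω ζ c d C D) (fun t => u₂ t - (E : ℂ) * exp (-(η : ℂ) * t))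

/-- `∑ (|C_n|² + |d_n D_n|²)`, with values in `[0, ∞]`. -/
noncomputable def coeffEnergy (d C D : ℕ → ℂ) : ENNReal :=
  ∑' n, (‖C n‖ₑ ^ 2 + ‖d n * D n‖ₑ ^ 2)

/-! The whole argument needs only `γ T > 2π`, which the assumption on `T` implies. At high frequency
the system decouples. Since `c_n → 0` and `1/d_n → 0`, the signal `u₁` is essentially the pair sum
of the `C_n` over the `ω_n`, and `u₂` that of the `d_n D_n` over the `ζ_n`, up to exponentials with
real exponents. Multiplication by `e^{αt}` makes the frequencies `ω_n` asymptotically real, so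
Ingham's method with a sine weight gives a Riesz lower bound for tails (`exists_lower`) on any
interval longer than `2π/γ`, and a Bessel upper bound on every interval. The direct inequality
follows from the latter and Cauchy–Schwarz for the `R_n`, whose bounds are square summable because
`ν > 1/2`.

The inverse inequality is proved by contradiction for finite sums: take coefficients of energy one
whose signals tend to zero. The infinitely many real exponentials form no finite-dimensional
perturbation, so one first shows that each fixed high-frequency coefficient tends to zero
(`exists_tendsto_coeff`). Part of the interval is spent on `k` forward differences. These multiply
an exponential `e^{zt}` by `(e^{zσ} - 1)^k`; for small `σ` this damps all exponents of bounded
modulus by a geometric factor relative to those of large modulus. The factor `4^k` paid on the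
signals is harmless, as the signals tend to zero while `k` is fixed.

Consequently the `R_n` with large index disappear in `ℓ¹`. The finitely many low coefficients
converge along an ultrafilter, the high part therefore converges in norm, and by the Riesz bound its
limit is the coordinatewise one, namely zero (`not_tendsto_zero`). What remains is a finite
exponential sum that vanishes on `(0,T)`. Linear independence of exponentials kills its
coefficients, contradicting unit energy. Both inequalities then pass to the limit along partial
sums. -/

/-! ### Ingham's estimate with a sine weight -/

theorem integral_sin_mul_exp_mul {p L : ℝ} (hpL : p * L = Real.pi) (z : ℂ) :
    (∫ t in (0 : ℝ)..L, (Real.sin (p * t) : ℂ) * exp (z * t)) * (z ^ 2 + p ^ 2)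
      = p * (1 + exp (z * L)) := by
  -- An explicit primitive of the integrand times `z² + p²`; keeping this factor on the left avoids
  -- dividing by zero at `z = ±ip`.
  have hderiv : ∀ t ∈ Set.uIcc 0 L, HasDerivAt
      (fun t : ℝ => exp (z * t) * (z * (Real.sin (p * t) : ℂ) - p * (Real.cos (p * t) : ℂ)))
      (((Real.sin (p * t) : ℂ) * exp (z * t)) * (z ^ 2 + p ^ 2)) t := by
    intro t _
    have h1 : HasDerivAt (fun t : ℝ => exp (z * t)) (exp (z * t) * z) t := by
      have := ((hasDerivAt_id (t : ℂ)).const_mul z).cexp.comp_ofReal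
      simpa using this
    have h0 : HasDerivAt (fun t : ℝ => p * t) p t := by
      simpa using (hasDerivAt_id t).const_mul p
    have h2 := (h0.sin).ofReal_comp
    have h3 := (h0.cos).ofReal_comp
    refine (h1.mul ((h2.const_mul z).sub (h3.const_mul (p : ℂ)))).congr_deriv ?_
    simp only [Pi.sub_apply]
    push_cast
    ring
  have hint : IntervalIntegrable
      (fun t : ℝ => ((Real.sin (p * t) : ℂ) * exp (z * t)) * (z ^ 2 + p ^ 2)) volume 0 L := by
    apply Continuous.intervalIntegrable
    fun_prop
  have := intervalIntegral.integral_eq_sub_of_hasDerivAt hderiv hint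
  rw [intervalIntegral.integral_mul_const] at this
  rw [this, hpL]
  simp
  ring

/-- The denominator `z² + p²` factors as `(z + ip)(z - ip)`, and each factor is at least its
imaginary part in modulus. The resulting quadratic decay in `Im z` is what makes the off-diagonal
sums converge. -/
theorem norm_integral_sin_mul_exp_le {p L : ℝ} (hp : 0 < p) (hpL : p * L = Real.pi) (z : ℂ)
    {D : ℝ} (hD : 0 < D) (hz : D ≤ z.im ^ 2 - p ^ 2) {A : ℝ} (hA : z.re * L ≤ A) :
    ‖∫ t in (0 : ℝ)..L, (Real.sin (p * t) : ℂ) * exp (z * t)‖ ≤ p * (1 + Real.exp A) / D := by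
  have h := congrArg norm (integral_sin_mul_exp_mul hpL z)
  rw [norm_mul, norm_mul] at h
  have h1 : D ≤ ‖z ^ 2 + (p : ℂ) ^ 2‖ := by
    have e : z ^ 2 + (p : ℂ) ^ 2 = (z + I * p) * (z - I * p) := by
      ring_nf
      rw [I_sq]; ring
    rw [e, norm_mul]
    have a1 := abs_im_le_norm (z + I * p)
    have a2 := abs_im_le_norm (z - I * p)
    simp at a1 a2
    calc D ≤ (z.im + p) * (z.im - p) := by nlinarith
      _ ≤ |z.im + p| * |z.im - p| := by rw [← abs_mul]; exact le_abs_self _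
      _ ≤ _ := by gcongr
  have h2 : ‖(1 : ℂ) + exp (z * L)‖ ≤ 1 + Real.exp A := by
    refine (norm_add_le _ _).trans ?_
    rw [norm_exp]
    simp
    exact hA
  rw [le_div_iff₀ hD]
  have h3 : ‖(p : ℂ)‖ = p := by simp [abs_of_pos hp]
  rw [h3] at h
  calc _ ≤ _ := mul_le_mul_of_nonneg_left h1 (norm_nonneg _)
    _ = _ := h
    _ ≤ _ := by gcongr

/-- Telescoping: `1/(m² - 1/4) = 1/(m - 1/2) - 1/(m + 1/2)`. -/
theorem sum_Icc_inv_sq_sub_quarter (n : ℕ) :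
    ∑ m ∈ Finset.Icc 1 n, ((m : ℝ) ^ 2 - 1 / 4)⁻¹ = 2 - ((n : ℝ) + 1 / 2)⁻¹ := by
  induction n with
  | zero => norm_num
  | succ n ih =>
    rw [Finset.sum_Icc_succ_top (by omega), ih]
    have h1 : ((n : ℝ) + 1 / 2) ≠ 0 := by positivity
    have h2 : ((n : ℝ) + 1 + 1 / 2) ≠ 0 := by positivity
    have h3 : ((n + 1 : ℕ) : ℝ) ^ 2 - 1 / 4 = ((n : ℝ) + 1 / 2) * (n + 1 + 1 / 2) := by
      push_cast; ring
    rw [h3]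
    push_cast
    field_simp
    ring

theorem sum_int_inv_sq_sub_quarter_le (A : Finset ℤ) (hA : (0 : ℤ) ∉ A) :
    ∑ m ∈ A, ((m : ℝ) ^ 2 - 1 / 4)⁻¹ ≤ 4 := by
  have hpos : ∀ m : ℤ, m ≠ 0 → 0 ≤ ((m : ℝ) ^ 2 - 1 / 4)⁻¹ := by
    intro m hm
    have : (1 : ℤ) ≤ m ^ 2 := by nlinarith [sq_nonneg m, Int.one_le_abs hm, sq_abs m]
    have h : (1 : ℝ) ≤ (m : ℝ) ^ 2 := by exact_mod_cast this
    exact inv_nonneg.2 (by linarith)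
  obtain ⟨n, hn⟩ : ∃ n : ℕ, ∀ m ∈ A, m.natAbs ≤ n :=
    ⟨A.sup Int.natAbs, fun m hm => Finset.le_sup (f := Int.natAbs) hm⟩
  let i₁ : ℕ → ℤ := fun m => m
  let i₂ : ℕ → ℤ := fun m => -m
  have hsub : A ⊆ (Finset.Icc 1 n).image i₁ ∪ (Finset.Icc 1 n).image i₂ := by
    intro m hm
    have h0 : m ≠ 0 := fun h => hA (h ▸ hm)
    have := hn m hm
    simp only [Finset.mem_union, Finset.mem_image, Finset.mem_Icc, i₁, i₂]
    rcases le_total 0 m with h | h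
    · exact Or.inl ⟨m.natAbs, by omega, by omega⟩
    · exact Or.inr ⟨m.natAbs, by omega, by omega⟩
  have hS := sum_Icc_inv_sq_sub_quarter n
  have hn0 : 0 ≤ ((n : ℝ) + 1 / 2)⁻¹ := by positivity
  have e1 : ∑ m ∈ (Finset.Icc 1 n).image i₁, ((m : ℝ) ^ 2 - 1 / 4)⁻¹ ≤ 2 := by
    rw [Finset.sum_image (by intro a _ b _ h; simpa [i₁] using h)]
    simp only [i₁, Int.cast_natCast]
    linarith
  have e2 : ∑ m ∈ (Finset.Icc 1 n).image i₂, ((m : ℝ) ^ 2 - 1 / 4)⁻¹ ≤ 2 := by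
    rw [Finset.sum_image (by intro a _ b _ h; simpa [i₂] using h)]
    simp only [i₂, Int.cast_neg, Int.cast_natCast, neg_sq]
    linarith
  have hnonneg : ∀ m ∈ (Finset.Icc 1 n).image i₁ ∪ (Finset.Icc 1 n).image i₂,
      0 ≤ ((m : ℝ) ^ 2 - 1 / 4)⁻¹ := by
    intro m hm
    apply hpos
    simp only [Finset.mem_union, Finset.mem_image, Finset.mem_Icc, i₁, i₂] at hm
    omega
  have hle := Finset.sum_le_sum_of_subset_of_nonneg hsub fun m hm _ => hnonneg m hm
  have hui := Finset.sum_union_inter (s₁ := (Finset.Icc 1 n).image i₁)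
    (s₂ := (Finset.Icc 1 n).image i₂) (f := fun m : ℤ => ((m : ℝ) ^ 2 - 1 / 4)⁻¹)
  have hinter : 0 ≤ ∑ m ∈ (Finset.Icc 1 n).image i₁ ∩ (Finset.Icc 1 n).image i₂,
      ((m : ℝ) ^ 2 - 1 / 4)⁻¹ := Finset.sum_nonneg fun m hm =>
    hnonneg m (Finset.mem_union_left _ (Finset.mem_inter.1 hm).1)
  linarith

/-- Symmetric Schur bound for a Hermitian-type kernel. -/
theorem norm_sum_offDiag_le {ι : Type*} [DecidableEq ι] (s : Finset ι) (b : ι → ℂ) (K : ι → ι → ℂ)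
    (k : ι → ι → ℝ) (hsymm : ∀ i j, k i j = k j i) {B : ℝ}
    (hK : ∀ i ∈ s, ∀ j ∈ s, i ≠ j → ‖K i j‖ ≤ k i j)
    (hB : ∀ i ∈ s, ∑ j ∈ s.erase i, k i j ≤ B) :
    ‖∑ i ∈ s, ∑ j ∈ s.erase i, b i * conj (b j) * K i j‖ ≤ B * ∑ i ∈ s, ‖b i‖ ^ 2 := by
  have hswap : ∑ i ∈ s, ∑ j ∈ s.erase i, ‖b j‖ ^ 2 * k i j
      = ∑ i ∈ s, ∑ j ∈ s.erase i, ‖b i‖ ^ 2 * k i j := by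
    rw [Finset.sum_comm' (t' := s) (s' := fun j => s.erase j)]
    · refine Finset.sum_congr rfl fun i _ => Finset.sum_congr rfl fun j _ => ?_
      rw [hsymm]
    · intro i j
      simp only [Finset.mem_erase]
      constructor
      · rintro ⟨a, b, c⟩; exact ⟨⟨fun h => b h.symm, a⟩, c⟩
      · rintro ⟨⟨a, b⟩, c⟩; exact ⟨b, fun h => a h.symm, c⟩
  calc _ ≤ ∑ i ∈ s, ∑ j ∈ s.erase i, (‖b i‖ ^ 2 * k i j + ‖b j‖ ^ 2 * k i j) / 2 := by
        refine norm_sum_le_of_le _ fun i hi => norm_sum_le_of_le _ fun j hj => ?_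
        have hk := hK i hi j (Finset.mem_of_mem_erase hj) (Finset.ne_of_mem_erase hj).symm
        rw [norm_mul, norm_mul, RCLike.norm_conj]
        have h0 : 0 ≤ k i j := (norm_nonneg _).trans hk
        calc _ ≤ ‖b i‖ * ‖b j‖ * k i j := by gcongr
          _ ≤ _ := by nlinarith [mul_nonneg (sq_nonneg (‖b i‖ - ‖b j‖)) h0]
    _ = ∑ i ∈ s, ∑ j ∈ s.erase i, ‖b i‖ ^ 2 * k i j := by
        simp only [← Finset.sum_div, Finset.sum_add_distrib]
        rw [hswap]; ring
    _ ≤ ∑ i ∈ s, ‖b i‖ ^ 2 * B := by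
        refine Finset.sum_le_sum fun i hi => ?_
        rw [← Finset.mul_sum]
        exact mul_le_mul_of_nonneg_left (hB i hi) (sq_nonneg _)
    _ = _ := by rw [← Finset.sum_mul, mul_comm]

/-- Ingham's estimate with the weight `sin (π t / L)`, for exponents in a thin strip. -/
theorem ingham_weighted {ι : Type*} (s : Finset ι) (z : ι → ℂ) (pos : ι → ℤ)
    (hpos : Set.InjOn pos s) {p L g ε κ : ℝ} (hp : 0 < p) (hL : 0 < L) (hpL : p * L = Real.pi)
    (hκ : 1 ≤ κ) (hg : 2 * p * κ ≤ g) (hre : ∀ i ∈ s, |(z i).re| ≤ ε)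
    (hgap : ∀ i ∈ s, ∀ j ∈ s, g * |(pos i : ℝ) - pos j| ≤ |(z i).im - (z j).im|) (b : ι → ℂ) :
    |(∫ t in (0 : ℝ)..L, Real.sin (p * t) * ‖∑ i ∈ s, b i * exp (z i * t)‖ ^ 2)
      - ∑ i ∈ s, ‖b i‖ ^ 2 * ∫ t in (0 : ℝ)..L, Real.sin (p * t) * Real.exp (2 * (z i).re * t)|
      ≤ (1 + Real.exp (2 * ε * L)) / (p * κ ^ 2) * ∑ i ∈ s, ‖b i‖ ^ 2 := by
  classical
  set K : ι → ι → ℂ := fun i j =>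
    ∫ t in (0 : ℝ)..L, (Real.sin (p * t) : ℂ) * exp ((z i + conj (z j)) * t) with hKdef
  have hexp : (((∫ t in (0 : ℝ)..L, Real.sin (p * t) * ‖∑ i ∈ s, b i * exp (z i * t)‖ ^ 2) : ℝ) : ℂ)
      = ∑ i ∈ s, ∑ j ∈ s, b i * conj (b j) * K i j := by
    rw [← intervalIntegral.integral_ofReal]
    have : ∀ t : ℝ, ((Real.sin (p * t) * ‖∑ i ∈ s, b i * exp (z i * t)‖ ^ 2 : ℝ) : ℂ)
        = ∑ i ∈ s, ∑ j ∈ s, b i * conj (b j) *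
          ((Real.sin (p * t) : ℂ) * exp ((z i + conj (z j)) * t)) := by
      intro t
      push_cast
      rw [← Complex.mul_conj', map_sum, Finset.sum_mul_sum, Finset.mul_sum]
      refine Finset.sum_congr rfl fun i _ => ?_
      rw [Finset.mul_sum]
      refine Finset.sum_congr rfl fun j _ => ?_
      rw [map_mul, ← exp_conj, map_mul, conj_ofReal, add_mul, exp_add]
      ring
    simp_rw [this]
    rw [intervalIntegral.integral_finsetSum]
    · refine Finset.sum_congr rfl fun i _ => ?_
      rw [intervalIntegral.integral_finsetSum]
      · refine Finset.sum_congr rfl fun j _ => ?_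
        rw [intervalIntegral.integral_const_mul]
      · intro j _
        apply Continuous.intervalIntegrable
        fun_prop
    · intro i _
      apply Continuous.intervalIntegrable
      fun_prop
  have hdiag : ∀ i, b i * conj (b i) * K i i = ((‖b i‖ ^ 2 *
      ∫ t in (0 : ℝ)..L, Real.sin (p * t) * Real.exp (2 * (z i).re * t) : ℝ) : ℂ) := by
    intro i
    rw [Complex.mul_conj']
    push_cast
    rw [← intervalIntegral.integral_ofReal, hKdef]
    congr 1
    refine intervalIntegral.integral_congr fun t _ => ?_
    rw [Complex.add_conj]
    push_cast
    ring_nf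
  -- With `m = pos j - pos i` the kernel decays like `1/(m² - 1/4)`. These weights sum to at most 4
  -- over nonzero integers, which cancels the 4 in the denominator.
  have hoff := norm_sum_offDiag_le s b K
    (fun i j => (1 + Real.exp (2 * ε * L)) / (4 * p * κ ^ 2) *
      (((pos j - pos i : ℤ) : ℝ) ^ 2 - 1 / 4)⁻¹)
    (fun i j => by push_cast; ring_nf) (B := (1 + Real.exp (2 * ε * L)) / (p * κ ^ 2)) ?_ ?_
  · have e : ∑ i ∈ s, ∑ j ∈ s, b i * conj (b j) * K i j
        = (∑ i ∈ s, b i * conj (b i) * K i i)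
          + ∑ i ∈ s, ∑ j ∈ s.erase i, b i * conj (b j) * K i j := by
      rw [← Finset.sum_add_distrib]
      exact Finset.sum_congr rfl fun i hi => (Finset.add_sum_erase s _ hi).symm
    rw [e] at hexp
    rw [← Real.norm_eq_abs, ← Complex.norm_real, ofReal_sub, hexp, ofReal_sum,
      Finset.sum_congr rfl fun i _ => hdiag i, add_sub_cancel_left]
    exact hoff
  · intro i hi j hj hij
    have hne : pos j - pos i ≠ 0 := fun h => hij (hpos hi hj (by omega))
    set m : ℤ := pos j - pos i with hm
    have h1 : (1 : ℝ) ≤ (m : ℝ) ^ 2 := by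
      have : (1 : ℤ) ≤ m ^ 2 := by nlinarith [sq_nonneg m, Int.one_le_abs hne, sq_abs m]
      exact_mod_cast this
    have hg0 : 0 < g := lt_of_lt_of_le (by positivity) hg
    have h2 : (g * |(m : ℝ)|) ^ 2 ≤ ((z i).im - (z j).im) ^ 2 := by
      rw [← sq_abs ((z i).im - (z j).im)]
      refine pow_le_pow_left₀ (by positivity) ?_ 2
      have := hgap i hi j hj
      rw [abs_sub_comm (pos i : ℝ)] at this
      simpa [hm] using this
    have h3 : (2 * p * κ) ^ 2 * (m : ℝ) ^ 2 ≤ ((z i).im - (z j).im) ^ 2 := by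
      rw [mul_pow, sq_abs] at h2
      refine le_trans ?_ h2
      gcongr
    -- Here `κ ≥ 1` enters: subtracting `p²κ²` in place of `p²` only decreases the bound and
    -- exhibits `m² - 1/4`.
    have h4 : 4 * p ^ 2 * κ ^ 2 * ((m : ℝ) ^ 2 - 1 / 4) ≤ ((z i + conj (z j)).im) ^ 2 - p ^ 2 := by
      simp only [add_im, conj_im, ← sub_eq_add_neg]
      nlinarith [mul_nonneg (sq_nonneg p) (by nlinarith : (0 : ℝ) ≤ κ ^ 2 - 1)]
    have h5 : (z i + conj (z j)).re * L ≤ 2 * ε * L := by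
      simp only [add_re, conj_re]
      have a1 := (le_abs_self _).trans (hre i hi)
      have a2 := (le_abs_self _).trans (hre j hj)
      gcongr
      linarith
    have hD : 0 < 4 * p ^ 2 * κ ^ 2 * ((m : ℝ) ^ 2 - 1 / 4) :=
      mul_pos (by positivity) (by linarith)
    refine (norm_integral_sin_mul_exp_le hp hpL _ hD h4 h5).trans (le_of_eq ?_)
    have : (m : ℝ) ^ 2 - 1 / 4 ≠ 0 := by linarith
    field_simp
  · intro i hi
    rw [← Finset.mul_sum]
    have : ∑ j ∈ s.erase i, (((pos j - pos i : ℤ) : ℝ) ^ 2 - 1 / 4)⁻¹ ≤ 4 := by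
      have himg := Finset.sum_image (s := s.erase i) (g := fun j => pos j - pos i)
        (f := fun m : ℤ => ((m : ℝ) ^ 2 - 1 / 4)⁻¹) (by
          intro a ha c hc h
          exact hpos (Finset.mem_of_mem_erase ha) (Finset.mem_of_mem_erase hc)
            (by simpa using h))
      rw [← himg]
      apply sum_int_inv_sq_sub_quarter_le
      simp only [Finset.mem_image, not_exists, not_and]
      intro j hj h
      exact Finset.ne_of_mem_erase hj
        (hpos (Finset.mem_of_mem_erase hj) hi (by omega))
    calc _ ≤ (1 + Real.exp (2 * ε * L)) / (4 * p * κ ^ 2) * 4 := by gcongr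
      _ = _ := by field_simp

/-! ### Squared norms on intervals and Ingham's two bounds -/

/-- The squared `L²(0, L)` norm of a function, as an interval integral. -/
noncomputable def sqInt (L : ℝ) (f : ℝ → ℂ) : ℝ := ∫ t in (0 : ℝ)..L, ‖f t‖ ^ 2

theorem sqInt_nonneg {L : ℝ} (hL : 0 ≤ L) (f : ℝ → ℂ) : 0 ≤ sqInt L f :=
  intervalIntegral.integral_nonneg hL fun _ _ => by positivity

theorem sqInt_mono {L L' : ℝ} (hL : 0 ≤ L) (h : L ≤ L') {f : ℝ → ℂ} (hf : Continuous f) :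
    sqInt L f ≤ sqInt L' f := by
  apply intervalIntegral.integral_mono_interval le_rfl hL h
  · exact Eventually.of_forall fun t => by simp only [Pi.zero_apply]; positivity
  · exact Continuous.intervalIntegrable (by fun_prop) _ _

theorem sqInt_le_mul {L K : ℝ} (hL : 0 ≤ L) {f g : ℝ → ℂ} (hf : Continuous f) (hg : Continuous g)
    (h : ∀ t, 0 ≤ t → t ≤ L → ‖f t‖ ^ 2 ≤ K * ‖g t‖ ^ 2) : sqInt L f ≤ K * sqInt L g := by
  unfold sqInt
  rw [← intervalIntegral.integral_const_mul]
  apply intervalIntegral.integral_mono_on hL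
  · exact Continuous.intervalIntegrable (by fun_prop) _ _
  · exact Continuous.intervalIntegrable (by fun_prop) _ _
  · exact fun t ht => h t ht.1 ht.2

theorem sqInt_le_of_norm_le {L K : ℝ} (hL : 0 ≤ L) {f : ℝ → ℂ} (hf : Continuous f)
    (h : ∀ t, 0 ≤ t → t ≤ L → ‖f t‖ ≤ K) : sqInt L f ≤ L * K ^ 2 := by
  have := sqInt_le_mul (K := K ^ 2) hL hf (g := fun _ => 1) continuous_const (fun t h0 h1 => by
    simpa using pow_le_pow_left₀ (norm_nonneg _) (h t h0 h1) 2)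
  simpa [sqInt, mul_comm] using this

theorem sqInt_add_le {L : ℝ} (hL : 0 ≤ L) {f g : ℝ → ℂ} (hf : Continuous f) (hg : Continuous g) :
    sqInt L (fun t => f t + g t) ≤ 2 * sqInt L f + 2 * sqInt L g := by
  unfold sqInt
  rw [← intervalIntegral.integral_const_mul, ← intervalIntegral.integral_const_mul,
    ← intervalIntegral.integral_add]
  · apply intervalIntegral.integral_mono_on hL
    · exact Continuous.intervalIntegrable (by fun_prop) _ _
    · exact Continuous.intervalIntegrable (by fun_prop) _ _
    · intro t _
      have := norm_add_le (f t) (g t)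
      nlinarith [sq_nonneg (‖f t‖ - ‖g t‖), norm_nonneg (f t + g t)]
  · exact Continuous.intervalIntegrable (by fun_prop) _ _
  · exact Continuous.intervalIntegrable (by fun_prop) _ _

theorem sqInt_neg (L : ℝ) (f : ℝ → ℂ) : sqInt L (fun t => -f t) = sqInt L f := by
  simp [sqInt]

theorem sqInt_sub_le {L : ℝ} (hL : 0 ≤ L) {f g : ℝ → ℂ} (hf : Continuous f) (hg : Continuous g) :
    sqInt L (fun t => f t - g t) ≤ 2 * sqInt L f + 2 * sqInt L g := by
  have h := sqInt_add_le hL hf hg.neg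
  rw [show sqInt L (-g) = sqInt L g from sqInt_neg L g] at h
  simpa [sub_eq_add_neg] using h

theorem integral_sin_mul_eq {p L : ℝ} (hp : 0 < p) (hpL : p * L = Real.pi) :
    ∫ t in (0 : ℝ)..L, Real.sin (p * t) = 2 / p := by
  rw [intervalIntegral.integral_comp_mul_left (fun x => Real.sin x) hp.ne', hpL]
  simp
  ring

theorem sin_mul_nonneg {p L : ℝ} (hp : 0 < p) (hpL : p * L = Real.pi) {t : ℝ}
    (h0 : 0 ≤ t) (h1 : t ≤ L) : 0 ≤ Real.sin (p * t) :=
  Real.sin_nonneg_of_nonneg_of_le_pi (by positivity) (by rw [← hpL]; gcongr)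

/-- Ingham's lower bound for almost real frequencies. -/
theorem exists_ingham_lower {L g : ℝ} (hL : 0 < L) (hgL : 2 * Real.pi < g * L) :
    ∃ ε > 0, ∃ c > 0, ∀ {ι : Type} (s : Finset ι) (z : ι → ℂ) (pos : ι → ℤ),
      Set.InjOn pos s → (∀ i ∈ s, |(z i).re| ≤ ε) →
      (∀ i ∈ s, ∀ j ∈ s, g * |(pos i : ℝ) - pos j| ≤ |(z i).im - (z j).im|) →
      ∀ b : ι → ℂ, c * ∑ i ∈ s, ‖b i‖ ^ 2 ≤ sqInt L (fun t => ∑ i ∈ s, b i * exp (z i * t)) := by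
  have hpi := Real.pi_pos
  set p : ℝ := Real.pi / L with hpdef
  have hp : 0 < p := by positivity
  have hpL : p * L = Real.pi := by rw [hpdef]; field_simp
  set κ : ℝ := g * L / (2 * Real.pi) with hκdef
  have hκ : 1 < κ := by rw [hκdef, one_lt_div (by positivity)]; exact hgL
  have hg : 2 * p * κ = g := by rw [hκdef, hpdef]; field_simp
  have hκ2 : 1 < κ ^ 2 := by nlinarith
  have hcont : Continuous fun ε : ℝ =>
      Real.exp (-(2 * ε * L)) * (2 / p) - (1 + Real.exp (2 * ε * L)) / (p * κ ^ 2) := by fun_prop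
  -- For real frequencies the diagonal contributes `2/p` and the off-diagonal part at most
  -- `2/(pκ²)`, so `κ > 1` leaves a positive margin. By continuity it survives in a thin strip.
  have h0 : 0 < Real.exp (-(2 * 0 * L)) * (2 / p) - (1 + Real.exp (2 * 0 * L)) / (p * κ ^ 2) := by
    simp only [mul_zero, zero_mul, neg_zero, Real.exp_zero, one_mul, sub_pos]
    rw [div_lt_div_iff₀ (by positivity) hp]
    nlinarith
  have hev := (hcont.tendsto 0).eventually (lt_mem_nhds h0)
  obtain ⟨δ, hδ, hball⟩ := Metric.eventually_nhds_iff.1 hev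
  have hε := @hball (δ / 2) (by simp [abs_of_pos hδ]; linarith)
  refine ⟨δ / 2, by positivity, _, hε, ?_⟩
  intro ι s z pos hinj hre hgap b
  set ε := δ / 2
  have hing := ingham_weighted s z pos hinj hp hL hpL hκ.le hg.le hre hgap b
  have hdiag : Real.exp (-(2 * ε * L)) * (2 / p) * ∑ i ∈ s, ‖b i‖ ^ 2 ≤
      ∑ i ∈ s, ‖b i‖ ^ 2 * ∫ t in (0 : ℝ)..L, Real.sin (p * t) * Real.exp (2 * (z i).re * t) := by
    rw [Finset.mul_sum]
    refine Finset.sum_le_sum fun i hi => ?_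
    rw [mul_comm]
    gcongr
    rw [← integral_sin_mul_eq hp hpL, ← intervalIntegral.integral_const_mul]
    apply intervalIntegral.integral_mono_on hL.le
    · exact Continuous.intervalIntegrable (by fun_prop) _ _
    · exact Continuous.intervalIntegrable (by fun_prop) _ _
    · intro t ht
      rw [mul_comm]
      have := sin_mul_nonneg hp hpL ht.1 ht.2
      gcongr
      have h1 := (abs_le.1 (hre i hi)).1
      have hε0 : 0 < ε := by positivity
      nlinarith [ht.1, ht.2, mul_nonneg ht.1 (by linarith : 0 ≤ (z i).re + ε)]
  have hw : (∫ t in (0 : ℝ)..L, Real.sin (p * t) * ‖∑ i ∈ s, b i * exp (z i * t)‖ ^ 2)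
      ≤ sqInt L (fun t => ∑ i ∈ s, b i * exp (z i * t)) := by
    apply intervalIntegral.integral_mono_on hL.le
    · exact Continuous.intervalIntegrable (by fun_prop) _ _
    · exact Continuous.intervalIntegrable (by fun_prop) _ _
    · intro t _
      exact mul_le_of_le_one_left (by positivity) (Real.sin_le_one _)
  have := (abs_le.1 hing).1
  rw [sub_mul]
  linarith

/-- Ingham's upper bound, for frequencies in any strip and any interval. -/
theorem exists_ingham_upper {L g B : ℝ} (hL : 0 < L) (hg : 0 < g) (hB : 0 ≤ B) :
    ∃ c > 0, ∀ {ι : Type} (s : Finset ι) (z : ι → ℂ) (pos : ι → ℤ),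
      Set.InjOn pos s → (∀ i ∈ s, |(z i).re| ≤ B) →
      (∀ i ∈ s, ∀ j ∈ s, g * |(pos i : ℝ) - pos j| ≤ |(z i).im - (z j).im|) →
      ∀ b : ι → ℂ, sqInt L (fun t => ∑ i ∈ s, b i * exp (z i * t)) ≤ c * ∑ i ∈ s, ‖b i‖ ^ 2 := by
  have hpi := Real.pi_pos
  -- The interval is enlarged to length `3L'`, long enough for the weighted estimate with `κ = 1`.
  -- The weight is bounded below on the middle third, which has length `L' ≥ L`.
  set L' : ℝ := max L (2 * Real.pi / g) with hL'
  have hL'0 : 0 < L' := lt_max_of_lt_left hL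
  have hgL : 2 * Real.pi ≤ g * L' := by
    have := le_max_right L (2 * Real.pi / g)
    rw [div_le_iff₀ hg] at this
    linarith
  set p : ℝ := Real.pi / (3 * L') with hpdef
  have hp : 0 < p := by positivity
  have hpL : p * (3 * L') = Real.pi := by rw [hpdef]; field_simp
  have hgp : 2 * p * 1 ≤ g := by nlinarith
  set A : ℝ := 3 * L' * Real.exp (2 * B * (3 * L')) +
    (1 + Real.exp (2 * B * (3 * L'))) / (p * 1 ^ 2) with hA
  refine ⟨2 * (A * Real.exp (B * L') ^ 2), by positivity, ?_⟩
  intro ι s z pos hinj hre hgap b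
  -- Translation by `L'` carries `[0, L']` to the middle third; in the coefficients it is absorbed
  -- by factors of modulus at most `e^{BL'}`.
  set b' : ι → ℂ := fun i => b i * exp (-(z i * L')) with hb'
  set F : ℝ → ℂ := fun t => ∑ i ∈ s, b' i * exp (z i * t) with hF
  have hFc : Continuous F := by fun_prop
  have hing := ingham_weighted s z pos hinj hp (by positivity) hpL le_rfl hgp hre hgap b'
  have hdiag : ∑ i ∈ s, ‖b' i‖ ^ 2 * ∫ t in (0 : ℝ)..(3 * L'),
      Real.sin (p * t) * Real.exp (2 * (z i).re * t) ≤
      3 * L' * Real.exp (2 * B * (3 * L')) * ∑ i ∈ s, ‖b' i‖ ^ 2 := by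
    rw [Finset.mul_sum]
    refine Finset.sum_le_sum fun i hi => ?_
    rw [mul_comm]
    gcongr
    have : ∫ _ in (0 : ℝ)..(3 * L'), Real.exp (2 * B * (3 * L'))
        = 3 * L' * Real.exp (2 * B * (3 * L')) := by simp
    rw [← this]
    apply intervalIntegral.integral_mono_on (by positivity)
    · exact Continuous.intervalIntegrable (by fun_prop) _ _
    · exact Continuous.intervalIntegrable (by fun_prop) _ _
    · intro t ht
      have h1 := (abs_le.1 (hre i hi)).2
      calc _ ≤ 1 * Real.exp (2 * (z i).re * t) := by gcongr; exact Real.sin_le_one _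
        _ ≤ _ := by
          rw [one_mul]
          gcongr
          · exact ht.1
          · exact ht.2
  have hsumb : ∑ i ∈ s, ‖b' i‖ ^ 2 ≤ Real.exp (B * L') ^ 2 * ∑ i ∈ s, ‖b i‖ ^ 2 := by
    rw [Finset.mul_sum]
    refine Finset.sum_le_sum fun i hi => ?_
    rw [hb', norm_mul, mul_pow, mul_comm, norm_exp]
    gcongr
    simp only [neg_re, mul_re, ofReal_re, ofReal_im, mul_zero, sub_zero]
    have := (abs_le.1 (hre i hi)).1
    nlinarith
  have hshift : sqInt L' (fun t => ∑ i ∈ s, b i * exp (z i * t))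
      = ∫ t in L'..(2 * L'), ‖F t‖ ^ 2 := by
    have := intervalIntegral.integral_comp_add_right (a := 0) (b := L') (fun t => ‖F t‖ ^ 2) L'
    rw [zero_add, ← two_mul] at this
    rw [← this, sqInt]
    refine intervalIntegral.integral_congr fun t _ => ?_
    simp only [hF, hb']
    congr 2
    refine Finset.sum_congr rfl fun i _ => ?_
    rw [mul_assoc, ← exp_add]
    congr 2
    push_cast
    ring
  have hw : (∫ t in L'..(2 * L'), ‖F t‖ ^ 2)
      ≤ 2 * ∫ t in (0 : ℝ)..(3 * L'), Real.sin (p * t) * ‖F t‖ ^ 2 := by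
    have h1 : (∫ t in L'..(2 * L'), ‖F t‖ ^ 2)
        ≤ 2 * ∫ t in L'..(2 * L'), Real.sin (p * t) * ‖F t‖ ^ 2 := by
      rw [← intervalIntegral.integral_const_mul]
      apply intervalIntegral.integral_mono_on (by linarith)
      · exact Continuous.intervalIntegrable (by fun_prop) _ _
      · exact Continuous.intervalIntegrable (by fun_prop) _ _
      · intro t ht
        have hs : 1 / 2 ≤ Real.sin (p * t) := by
          rw [← Real.cos_sub_pi_div_two, ← Real.cos_abs, ← Real.cos_pi_div_three]
          have e1 : Real.pi / 3 = p * L' := by rw [← hpL]; ring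
          have h3 : p * L' ≤ p * t := by gcongr; exact ht.1
          have h4 : p * t ≤ 2 * (p * L') := by nlinarith [ht.2]
          have h5 : |p * t - Real.pi / 2| ≤ Real.pi / 3 := by
            rw [abs_le]; constructor <;> linarith
          exact Real.cos_le_cos_of_nonneg_of_le_pi (abs_nonneg _) (by linarith) h5
        nlinarith [sq_nonneg ‖F t‖]
    refine h1.trans ?_
    gcongr
    apply intervalIntegral.integral_mono_interval hL'0.le (by linarith) (by linarith)
    · refine (ae_restrict_iff' measurableSet_Ioc).2 (Eventually.of_forall fun t ht => ?_)
      exact mul_nonneg (sin_mul_nonneg hp hpL ht.1.le ht.2) (by positivity)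
    · exact Continuous.intervalIntegrable (by fun_prop) _ _
  have hmono := sqInt_mono hL.le (le_max_left L (2 * Real.pi / g))
    (f := fun t => ∑ i ∈ s, b i * exp (z i * t)) (by fun_prop)
  rw [← hL'] at hmono
  have h6 : ∫ t in (0 : ℝ)..(3 * L'), Real.sin (p * t) * ‖F t‖ ^ 2
      ≤ A * ∑ i ∈ s, ‖b' i‖ ^ 2 := by
    have := (abs_le.1 hing).2
    rw [hA, add_mul]
    linarith
  have hA0 : 0 ≤ A := by positivity
  calc _ ≤ _ := hmono
    _ = _ := hshift
    _ ≤ _ := hw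
    _ ≤ 2 * (A * (Real.exp (B * L') ^ 2 * ∑ i ∈ s, ‖b i‖ ^ 2)) := by
      refine mul_le_mul_of_nonneg_left (h6.trans ?_) (by norm_num)
      exact mul_le_mul_of_nonneg_left hsumb hA0
    _ = _ := by ring

/-! ### Sums of conjugate pairs -/

/-- The finite sum `∑ (a_n e^{iω_n t} + conj)` over `n ∈ s`. -/
noncomputable def pairSum (s : Finset ℕ) (a ω : ℕ → ℂ) (t : ℝ) : ℂ :=
  ∑ n ∈ s, conjPairExp (a n) (ω n) t

@[fun_prop]
theorem continuous_conjPairExp (A σ : ℂ) : Continuous (conjPairExp A σ) := by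
  unfold conjPairExp
  fun_prop

@[fun_prop]
theorem continuous_pairSum (s : Finset ℕ) (a ω : ℕ → ℂ) : Continuous (pairSum s a ω) := by
  unfold pairSum
  fun_prop

/-- Both exponents of a pair have the same real part, so one real exponential factor shifts them
together. It moves frequencies near the line `Im = β` to the real axis. -/
theorem conjPairExp_shift (A σ : ℂ) (β t : ℝ) :
    conjPairExp A σ t = exp (-(β * t : ℝ)) * conjPairExp A (σ - I * β) t := by
  simp only [conjPairExp, mul_add, map_sub, map_mul, conj_I, conj_ofReal]
  rw [mul_left_comm, ← exp_add, mul_left_comm, ← exp_add]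
  congr 3
  · push_cast
    linear_combination ((β : ℂ) * t) * I_sq
  · push_cast
    linear_combination ((β : ℂ) * t) * I_sq

theorem pairSum_shift (s : Finset ℕ) (a ω : ℕ → ℂ) (β t : ℝ) :
    pairSum s a ω t = exp (-(β * t : ℝ)) * pairSum s a (fun n => ω n - I * β) t := by
  simp only [pairSum, Finset.mul_sum]
  exact Finset.sum_congr rfl fun n _ => conjPairExp_shift _ _ _ _

/-- Exponents of `pairSum`, indexed by `ℕ × Bool`. -/
noncomputable def pairExponent (ω : ℕ → ℂ) (i : ℕ × Bool) : ℂ :=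
  if i.2 then I * ω i.1 else -I * conj (ω i.1)

/-- Coefficients of `pairSum`, indexed by `ℕ × Bool`. -/
noncomputable def pairCoeff (a : ℕ → ℂ) (i : ℕ × Bool) : ℂ :=
  if i.2 then a i.1 else conj (a i.1)

theorem pairSum_eq_sum (s : Finset ℕ) (a ω : ℕ → ℂ) :
    pairSum s a ω = fun t : ℝ => ∑ i ∈ s ×ˢ (Finset.univ : Finset Bool),
      pairCoeff a i * exp (pairExponent ω i * t) := by
  funext t
  rw [Finset.sum_product]
  simp [pairSum, conjPairExp, pairCoeff, pairExponent]

theorem sum_norm_pairCoeff_sq (s : Finset ℕ) (a : ℕ → ℂ) :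
    ∑ i ∈ s ×ˢ (Finset.univ : Finset Bool), ‖pairCoeff a i‖ ^ 2 = 2 * ∑ n ∈ s, ‖a n‖ ^ 2 := by
  rw [Finset.sum_product, Finset.mul_sum]
  refine Finset.sum_congr rfl fun n _ => ?_
  simp [pairCoeff]
  ring

/-- The position of the frequency with a given index on the real line. -/
def pairPos (i : ℕ × Bool) : ℤ := if i.2 then (i.1 : ℤ) else -(i.1 : ℤ) - 1

theorem pairPos_injective : Function.Injective pairPos := by
  rintro ⟨n, b⟩ ⟨m, b'⟩ h
  cases b <;> cases b' <;> simp [pairPos] at h ⊢ <;> omega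

theorem abs_re_pairExponent (ω : ℕ → ℂ) (i : ℕ × Bool) :
    |(pairExponent ω i).re| = |(ω i.1).im| := by
  rcases i with ⟨n, b⟩
  cases b <;> simp [pairExponent]

theorem sub_le_of_gap {x : ℕ → ℝ} {g : ℝ} {N : ℕ} (h : ∀ n ≥ N, g ≤ x (n + 1) - x n)
    {n m : ℕ} (hn : N ≤ n) (hnm : n ≤ m) : g * ((m : ℝ) - n) ≤ x m - x n := by
  induction m, hnm using Nat.le_induction with
  | base => simp
  | succ m hm ih =>
    have := h m (by omega)
    push_cast
    linarith

/-- The frequencies `Re ω_n` and their reflections are compared with the integers `n` and `-n - 1`.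
Two indices on the same side use the gap; indices on opposite sides are `n + m + 1` apart, so there
the lower bound `g (n + 1)` for `Re ω_n` is used twice. -/
theorem pairExponent_gap {ω : ℕ → ℂ} {g : ℝ} {N : ℕ} (hg : 0 ≤ g)
    (h : ∀ n ≥ N, g ≤ (ω (n + 1)).re - (ω n).re) (h' : ∀ n ≥ N, g * (n + 1) ≤ (ω n).re)
    {i j : ℕ × Bool} (hi : N ≤ i.1) (hj : N ≤ j.1) :
    g * |(pairPos i : ℝ) - pairPos j| ≤ |(pairExponent ω i).im - (pairExponent ω j).im| := by
  have key : ∀ n m : ℕ, N ≤ n → N ≤ m → g * |(n : ℝ) - m| ≤ |(ω n).re - (ω m).re| := by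
    intro n m hn hm
    rcases le_total n m with hnm | hnm
    · have := sub_le_of_gap (x := fun k => (ω k).re) h hn hnm
      rw [abs_sub_comm, abs_sub_comm (ω n).re, abs_of_nonneg (a := (m : ℝ) - n)
        (by rw [sub_nonneg]; exact_mod_cast hnm)]
      exact this.trans (le_abs_self _)
    · have := sub_le_of_gap (x := fun k => (ω k).re) h hm hnm
      rw [abs_of_nonneg (a := (n : ℝ) - m) (by rw [sub_nonneg]; exact_mod_cast hnm)]
      exact this.trans (le_abs_self _)
  have key2 : ∀ n m : ℕ, N ≤ n → N ≤ m → g * ((n : ℝ) + m + 1) ≤ (ω n).re + (ω m).re := by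
    intro n m hn hm
    have h1 := h' n hn
    have h2 := h' m hm
    linarith
  rcases i with ⟨n, b⟩
  rcases j with ⟨m, b'⟩
  have k1 := key n m hi hj
  have k2 := key2 n m hi hj
  cases b <;> cases b' <;> simp only [pairPos, pairExponent, if_true, Bool.false_eq_true, if_false,
    neg_mul, neg_im, mul_im, I_re, I_im, zero_mul, one_mul, conj_re, conj_im, zero_add] <;>
    push_cast
  · rwa [show -(n : ℝ) - 1 - (-m - 1) = -((n : ℝ) - m) by ring, abs_neg,
      show -(ω n).re - -(ω m).re = -((ω n).re - (ω m).re) by ring, abs_neg]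
  · rw [show -(n : ℝ) - 1 - m = -((n : ℝ) + m + 1) by ring, abs_neg,
      show -(ω n).re - (ω m).re = -((ω n).re + (ω m).re) by ring, abs_neg,
      abs_of_nonneg (by positivity)]
    exact k2.trans (le_abs_self _)
  · rw [show (n : ℝ) - (-m - 1) = (n : ℝ) + m + 1 by ring,
      show (ω n).re - -(ω m).re = (ω n).re + (ω m).re by ring, abs_of_nonneg (by positivity)]
    exact k2.trans (le_abs_self _)
  · exact k1

/-- Eventual gap conditions extracted from a lower limit. -/
theorem exists_gap_of_liminf {ω : ℕ → ℂ} {γ g : ℝ}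
    (h : liminf (fun n => (((ω (n + 1)).re - (ω n).re : ℝ) : EReal)) atTop = (γ : EReal))
    (hg : g < γ) :
    ∃ N, (∀ n ≥ N, g ≤ (ω (n + 1)).re - (ω n).re) ∧ ∀ n ≥ N, g * (n + 1) ≤ (ω n).re := by
  obtain ⟨g', hgg', hg'γ⟩ := exists_between hg
  have hev : ∀ᶠ n in atTop, (g' : EReal) < (((ω (n + 1)).re - (ω n).re : ℝ) : EReal) :=
    eventually_lt_of_lt_liminf (by rw [h]; exact_mod_cast hg'γ)
  obtain ⟨N, hN⟩ := eventually_atTop.1 hev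
  have hgap : ∀ n ≥ N, g' ≤ (ω (n + 1)).re - (ω n).re := fun n hn => by
    have := hN n hn
    exact (EReal.coe_lt_coe_iff.1 this).le
  -- The surplus `g' - g` per step eventually outweighs the unknown starting value `Re ω_N`.
  obtain ⟨K, hK⟩ := exists_nat_ge ((g + g' * N - (ω N).re) / (g' - g))
  refine ⟨max N K, fun n hn => hgg'.le.trans (hgap n (le_of_max_le_left hn)), fun n hn => ?_⟩
  have h1 := sub_le_of_gap (x := fun k => (ω k).re) hgap le_rfl (le_of_max_le_left hn)
  have h2 : (K : ℝ) ≤ n := by exact_mod_cast le_of_max_le_right hn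
  have h3 := hK.trans h2
  rw [div_le_iff₀ (by linarith)] at h3
  linarith

theorem norm_conjPairExp_le (A σ : ℂ) (t : ℝ) :
    ‖conjPairExp A σ t‖ ≤ 2 * ‖A‖ * Real.exp (|σ.im| * |t|) := by
  have hle : -(σ.im * t) ≤ |σ.im| * |t| := by
    rw [← abs_mul]; exact neg_le_abs _
  have h1 : ‖exp (I * σ * t)‖ ≤ Real.exp (|σ.im| * |t|) := by
    rw [norm_exp]
    gcongr
    simpa using hle
  have h2 : ‖exp (-I * conj σ * t)‖ ≤ Real.exp (|σ.im| * |t|) := by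
    rw [norm_exp]
    gcongr
    simpa using hle
  calc _ ≤ ‖A‖ * ‖exp (I * σ * t)‖ + ‖A‖ * ‖exp (-I * conj σ * t)‖ := by
        unfold conjPairExp
        refine (norm_add_le _ _).trans ?_
        rw [norm_mul, norm_mul, RCLike.norm_conj]
    _ ≤ ‖A‖ * Real.exp (|σ.im| * |t|) + ‖A‖ * Real.exp (|σ.im| * |t|) := by gcongr
    _ = _ := by ring

/-- Lower (Riesz) bound for high-frequency conjugate pair sums. -/
theorem exists_pairSum_lower {ω : ℕ → ℂ} {γ β L : ℝ} (hL : 0 < L)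
    (hgap : liminf (fun n => (((ω (n + 1)).re - (ω n).re : ℝ) : EReal)) atTop = (γ : EReal))
    (him : Tendsto (fun n => (ω n).im) atTop (𝓝 β)) (hγL : 2 * Real.pi < γ * L) :
    ∃ N : ℕ, ∃ c > 0, ∀ s : Finset ℕ, (∀ n ∈ s, N ≤ n) → ∀ a : ℕ → ℂ,
      c * ∑ n ∈ s, ‖a n‖ ^ 2 ≤ sqInt L (pairSum s a ω) := by
  have hpi := Real.pi_pos
  obtain ⟨g, hg1, hg2⟩ := exists_between ((div_lt_iff₀ hL).2 hγL)
  have hg0 : 0 < g := lt_trans (by positivity) hg1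
  rw [div_lt_iff₀ hL] at hg1
  obtain ⟨N₁, hN₁, hN₁'⟩ := exists_gap_of_liminf hgap hg2
  obtain ⟨ε, hε, c, hc, hing⟩ := exists_ingham_lower hL hg1
  obtain ⟨N₂, hN₂⟩ := Metric.tendsto_atTop.1 him ε hε
  set K : ℝ := Real.exp (|β| * L) ^ 2 with hK
  refine ⟨max N₁ N₂, c * 2 / K, by positivity, fun s hs a => ?_⟩
  -- After the shift the imaginary parts tend to zero, hence lie in the thin strip from some index
  -- on. The factor `e^{βt}` costs the constant `K`.
  set ω' : ℕ → ℂ := fun n => ω n - I * β with hω'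
  have h1 := hing (s ×ˢ (Finset.univ : Finset Bool)) (pairExponent ω') pairPos
    pairPos_injective.injOn (fun i hi => by
      rw [abs_re_pairExponent]
      have := hN₂ i.1 (le_of_max_le_right (hs i.1 (Finset.mem_product.1 hi).1))
      rw [Real.dist_eq] at this
      simpa [hω'] using this.le) (fun i hi j hj => by
      apply pairExponent_gap (N := N₁) hg0.le
      · simpa [hω'] using hN₁
      · simpa [hω'] using hN₁'
      · exact le_of_max_le_left (hs i.1 (Finset.mem_product.1 hi).1)
      · exact le_of_max_le_left (hs j.1 (Finset.mem_product.1 hj).1)) (pairCoeff a)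
  rw [sum_norm_pairCoeff_sq, ← pairSum_eq_sum] at h1
  have h2 : sqInt L (pairSum s a ω') ≤ K * sqInt L (pairSum s a ω) := by
    apply sqInt_le_mul hL.le (by fun_prop) (by fun_prop)
    intro t h0 ht
    have e : ‖pairSum s a ω' t‖ ≤ Real.exp (|β| * L) * ‖pairSum s a ω t‖ := by
      rw [pairSum_shift s a ω β t, norm_mul, ← mul_assoc, norm_exp, ← Real.exp_add]
      refine le_mul_of_one_le_left (norm_nonneg _) (Real.one_le_exp ?_)
      simp only [neg_re, ofReal_re]
      have : β * t ≤ |β| * L := by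
        calc β * t ≤ |β| * t := by gcongr; exact le_abs_self _
          _ ≤ _ := by gcongr
      linarith
    rw [hK, ← mul_pow]
    exact pow_le_pow_left₀ (norm_nonneg _) e 2
  rw [div_mul_eq_mul_div, div_le_iff₀ (by positivity)]
  linarith

theorem sq_sum_le_of_subset_range {s : Finset ℕ} {N : ℕ} (hs : s ⊆ Finset.range N) (f : ℕ → ℝ) :
    (∑ n ∈ s, f n) ^ 2 ≤ N * ∑ n ∈ s, f n ^ 2 := by
  refine (sq_sum_le_card_mul_sum_sq (s := s) (f := f)).trans ?_
  refine mul_le_mul_of_nonneg_right ?_ (Finset.sum_nonneg fun n _ => sq_nonneg (f n))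
  simpa using Finset.card_le_card hs

/-- Upper (Bessel) bound for conjugate pair sums. -/
theorem exists_pairSum_upper {ω : ℕ → ℂ} {γ β L : ℝ} (hL : 0 < L) (hγ : 0 < γ)
    (hgap : liminf (fun n => (((ω (n + 1)).re - (ω n).re : ℝ) : EReal)) atTop = (γ : EReal))
    (him : Tendsto (fun n => (ω n).im) atTop (𝓝 β)) :
    ∃ c > 0, ∀ s : Finset ℕ, ∀ a : ℕ → ℂ,
      sqInt L (pairSum s a ω) ≤ c * ∑ n ∈ s, ‖a n‖ ^ 2 := by
  obtain ⟨N, hN, hN'⟩ := exists_gap_of_liminf hgap (half_lt_self hγ)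
  obtain ⟨B, hB⟩ := (Metric.isBounded_range_of_tendsto _ him).exists_norm_le
  have hB' : ∀ n, |(ω n).im| ≤ B := fun n => hB _ ⟨n, rfl⟩
  have hB0 : 0 ≤ B := (abs_nonneg _).trans (hB' 0)
  obtain ⟨c, hc, hing⟩ := exists_ingham_upper hL (half_pos hγ) hB0
  set K : ℝ := L * (4 * Real.exp (B * L) ^ 2 * N) with hK
  refine ⟨2 * (c * 2) + 2 * K, by positivity, fun s a => ?_⟩
  set s₁ := s.filter (fun n => N ≤ n)
  set s₂ := s.filter (fun n => ¬ N ≤ n)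
  have h1 : sqInt L (pairSum s₁ a ω) ≤ c * (2 * ∑ n ∈ s₁, ‖a n‖ ^ 2) := by
    have := hing (s₁ ×ˢ (Finset.univ : Finset Bool)) (pairExponent ω) pairPos
      pairPos_injective.injOn (fun i hi => by
        rw [abs_re_pairExponent]
        exact hB' _) (fun i hi j hj => by
        apply pairExponent_gap (N := N) (by positivity) hN hN'
        · exact (Finset.mem_filter.1 (Finset.mem_product.1 hi).1).2
        · exact (Finset.mem_filter.1 (Finset.mem_product.1 hj).1).2) (pairCoeff a)
    rwa [sum_norm_pairCoeff_sq, ← pairSum_eq_sum] at this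
  -- The fewer than `N + 1` terms below the threshold have no gap information; they are bounded
  -- pointwise and by Cauchy–Schwarz.
  have h2 : sqInt L (pairSum s₂ a ω) ≤ K * ∑ n ∈ s₂, ‖a n‖ ^ 2 := by
    have hb : ∀ t, 0 ≤ t → t ≤ L → ‖pairSum s₂ a ω t‖ ≤
        2 * Real.exp (B * L) * ∑ n ∈ s₂, ‖a n‖ := by
      intro t h0 ht
      rw [Finset.mul_sum]
      refine norm_sum_le_of_le _ fun n _ => (norm_conjPairExp_le _ _ _).trans ?_
      rw [mul_right_comm]
      gcongr
      · exact hB' n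
      · rwa [abs_of_nonneg h0]
    refine (sqInt_le_of_norm_le hL.le (by fun_prop) hb).trans ?_
    have := sq_sum_le_of_subset_range (s := s₂) (N := N) (fun n hn => by
      have := (Finset.mem_filter.1 hn).2
      simp; omega) (fun n => ‖a n‖)
    rw [mul_pow, mul_pow, hK]
    calc _ ≤ L * (2 ^ 2 * Real.exp (B * L) ^ 2 * (N * ∑ n ∈ s₂, ‖a n‖ ^ 2)) := by gcongr
      _ = _ := by ring
  have hsplit : pairSum s a ω = fun t => pairSum s₁ a ω t + pairSum s₂ a ω t := by
    funext t
    exact (Finset.sum_filter_add_sum_filter_not s _ _).symm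
  have h3 := sqInt_add_le hL.le (f := pairSum s₁ a ω) (g := pairSum s₂ a ω)
    (by fun_prop) (by fun_prop)
  have h4 := Finset.sum_filter_add_sum_filter_not s (fun n => N ≤ n) (fun n => ‖a n‖ ^ 2)
  have h5 : 0 ≤ ∑ n ∈ s₁, ‖a n‖ ^ 2 := Finset.sum_nonneg fun n _ => sq_nonneg _
  have h6 : 0 ≤ ∑ n ∈ s₂, ‖a n‖ ^ 2 := Finset.sum_nonneg fun n _ => sq_nonneg _
  rw [hsplit, ← h4]
  have hK0 : 0 ≤ K := by positivity
  nlinarith [mul_nonneg hc.le h6, mul_nonneg hK0 h5]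

/-! ### Iterated forward differences and linear independence of exponentials -/

theorem continuous_fwdDiff_iter (σ : ℝ) {f : ℝ → ℂ} (hf : Continuous f) (k : ℕ) :
    Continuous ((fwdDiff σ)^[k] f) := by
  induction k with
  | zero => simpa
  | succ k ih =>
    rw [Function.iterate_succ_apply']
    unfold fwdDiff at ih ⊢
    exact (ih.comp (continuous_id.add continuous_const)).sub ih

/-- Exponentials are eigenfunctions of the difference operator, with eigenvalue `e^{zσ} - 1`. -/
theorem fwdDiff_iter_exp (σ : ℝ) (b z : ℂ) (k : ℕ) :
    (fwdDiff σ)^[k] (fun t : ℝ => b * exp (z * t))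
      = fun t : ℝ => b * (exp (z * σ) - 1) ^ k * exp (z * t) := by
  induction k with
  | zero => simp
  | succ k ih =>
    rw [Function.iterate_succ_apply', ih]
    funext t
    simp only [fwdDiff]
    push_cast
    rw [mul_add, exp_add]
    ring

/-- For real `σ` the multipliers of the two conjugate exponents are conjugate, so differences
preserve the pair structure. -/
theorem fwdDiff_iter_conjPairExp (σ : ℝ) (A ω : ℂ) (k : ℕ) :
    (fwdDiff σ)^[k] (conjPairExp A ω) = conjPairExp (A * (exp (I * ω * σ) - 1) ^ k) ω := by
  have h : conjPairExp A ω = (fun t : ℝ => A * exp (I * ω * t)) +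
      fun t : ℝ => conj A * exp (-I * conj ω * t) := rfl
  rw [h, fwdDiff_iter_add, fwdDiff_iter_exp, fwdDiff_iter_exp]
  funext t
  simp only [Pi.add_apply, conjPairExp, map_mul, map_pow, map_sub, map_one, ← exp_conj, conj_I,
    conj_ofReal]

theorem fwdDiff_iter_pairSum (σ : ℝ) (s : Finset ℕ) (a ω : ℕ → ℂ) (k : ℕ) :
    (fwdDiff σ)^[k] (pairSum s a ω)
      = pairSum s (fun n => a n * (exp (I * ω n * σ) - 1) ^ k) ω := by
  have h : pairSum s a ω = ∑ n ∈ s, conjPairExp (a n) (ω n) := by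
    funext t
    simp [pairSum]
  rw [h, fwdDiff_iter_finsetSum]
  funext t
  simp [pairSum, fwdDiff_iter_conjPairExp]

theorem sqInt_fwdDiff_le {L σ : ℝ} (hL : 0 ≤ L) (hσ : 0 ≤ σ) {f : ℝ → ℂ} (hf : Continuous f) :
    sqInt L (fwdDiff σ f) ≤ 4 * sqInt (L + σ) f := by
  have h1 : sqInt L (fun t => f (t + σ)) ≤ sqInt (L + σ) f := by
    have := intervalIntegral.integral_comp_add_right (a := 0) (b := L) (fun t => ‖f t‖ ^ 2) σ
    rw [sqInt, this]
    apply intervalIntegral.integral_mono_interval (by linarith) (by linarith) le_rfl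
    · exact Eventually.of_forall fun t => by simp only [Pi.zero_apply]; positivity
    · exact Continuous.intervalIntegrable (by fun_prop) _ _
  have h2 := sqInt_mono hL (le_add_of_nonneg_right hσ) hf
  have h3 := sqInt_sub_le hL (f := fun t => f (t + σ)) (g := f) (by fun_prop) hf
  have h4 : fwdDiff σ f = fun t => f (t + σ) - f t := rfl
  rw [h4]
  linarith

/-- Each difference uses up length `σ` of the interval and costs a factor 4. -/
theorem sqInt_fwdDiff_iter_le {L σ : ℝ} (hL : 0 ≤ L) (hσ : 0 ≤ σ) {f : ℝ → ℂ} (hf : Continuous f)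
    (k : ℕ) : sqInt L ((fwdDiff σ)^[k] f) ≤ 4 ^ k * sqInt (L + k * σ) f := by
  induction k generalizing L with
  | zero => simp
  | succ k ih =>
    rw [Function.iterate_succ_apply']
    refine (sqInt_fwdDiff_le hL hσ (continuous_fwdDiff_iter σ hf k)).trans ?_
    have := ih (add_nonneg hL hσ)
    have e : L + ((k + 1 : ℕ) : ℝ) * σ = L + σ + k * σ := by push_cast; ring
    rw [e, pow_succ']
    linarith

/-- Iterated differences of `f` on `[0, T]` are bounded as for sums of exponentials `e^{zt}`
with `|z| ≤ B` and total weight at most `K`. -/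
def DiffBound (T B K : ℝ) (f : ℝ → ℂ) : Prop :=
  ∀ (k : ℕ) (σ : ℝ), 0 ≤ σ → ∀ t, 0 ≤ t → t ≤ T →
    ‖(fwdDiff σ)^[k] f t‖ ≤ K * (Real.exp (B * σ) - 1) ^ k

theorem DiffBound.add {T B K K' : ℝ} {f g : ℝ → ℂ} (hf : DiffBound T B K f)
    (hg : DiffBound T B K' g) : DiffBound T B (K + K') (fun t => f t + g t) := by
  intro k σ hσ t h0 ht
  have : (fun t => f t + g t) = f + g := rfl
  rw [this, fwdDiff_iter_add, Pi.add_apply, add_mul]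
  exact (norm_add_le _ _).trans (add_le_add (hf k σ hσ t h0 ht) (hg k σ hσ t h0 ht))

theorem DiffBound.sum {T B : ℝ} {s : Finset ℕ} {K : ℕ → ℝ} {f : ℕ → ℝ → ℂ}
    (hf : ∀ n ∈ s, DiffBound T B (K n) (f n)) :
    DiffBound T B (∑ n ∈ s, K n) (fun t => ∑ n ∈ s, f n t) := by
  intro k σ hσ t h0 ht
  have : (fun t => ∑ n ∈ s, f n t) = ∑ n ∈ s, f n := by
    funext t; simp
  rw [this, fwdDiff_iter_finsetSum, Finset.sum_apply, Finset.sum_mul]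
  exact norm_sum_le_of_le _ fun n hn => hf n hn k σ hσ t h0 ht

theorem DiffBound.mono {T B K K' : ℝ} (hB : 0 ≤ B) {f : ℝ → ℂ} (hf : DiffBound T B K f)
    (h : K ≤ K') : DiffBound T B K' f := by
  intro k σ hσ t h0 ht
  refine (hf k σ hσ t h0 ht).trans (mul_le_mul_of_nonneg_right h (pow_nonneg ?_ _))
  rw [sub_nonneg]
  exact Real.one_le_exp (by positivity)

/-- Compare the power series of `exp - 1` term by term. -/
theorem norm_exp_sub_one_le_of_le {z : ℂ} {B σ : ℝ} (hσ : 0 ≤ σ) (hz : ‖z‖ ≤ B) :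
    ‖exp (z * σ) - 1‖ ≤ Real.exp (B * σ) - 1 := by
  have h := norm_exp_sub_sum_le_exp_norm_sub_sum (z * σ) 1
  simp only [Finset.range_one, Finset.sum_singleton, pow_zero, Nat.factorial_zero, Nat.cast_one,
    div_one, norm_mul, norm_real, Real.norm_eq_abs, abs_of_nonneg hσ] at h
  refine h.trans (sub_le_sub_right (Real.exp_le_exp.2 ?_) _)
  gcongr

theorem diffBound_exp {T B : ℝ} {b z : ℂ} (hz : ‖z‖ ≤ B) :
    DiffBound T B (‖b‖ * Real.exp (B * T)) (fun t : ℝ => b * exp (z * t)) := by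
  intro k σ hσ t h0 ht
  have hB : 0 ≤ B := (norm_nonneg z).trans hz
  rw [fwdDiff_iter_exp, norm_mul, norm_mul, norm_pow, mul_right_comm]
  have h1 := norm_exp_sub_one_le_of_le hσ hz
  have h2 : ‖exp (z * t)‖ ≤ Real.exp (B * T) := by
    rw [norm_exp]
    gcongr
    calc (z * t).re ≤ ‖z * t‖ := re_le_norm _
      _ ≤ B * T := by
        rw [norm_mul, norm_real, Real.norm_eq_abs, abs_of_nonneg h0]
        gcongr
  gcongr

theorem diffBound_conjPairExp {T B : ℝ} {A ω : ℂ} (hω : ‖ω‖ ≤ B) :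
    DiffBound T B (2 * ‖A‖ * Real.exp (B * T)) (conjPairExp A ω) := by
  have h1 : DiffBound T B _ (fun t : ℝ => A * exp (I * ω * t)) :=
    diffBound_exp (by simpa using hω)
  have h2 : DiffBound T B _ (fun t : ℝ => conj A * exp (-I * conj ω * t)) :=
    diffBound_exp (by simpa using hω)
  have h3 := h1.add h2
  rw [RCLike.norm_conj, ← two_mul, ← mul_assoc] at h3
  exact h3

theorem DiffBound.sqInt_le {T B K L σ : ℝ} {f : ℝ → ℂ} (hf : DiffBound T B K f)
    (hfc : Continuous f) (hL : 0 ≤ L) (hLT : L ≤ T) (hσ : 0 ≤ σ) (k : ℕ) :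
    sqInt L ((fwdDiff σ)^[k] f) ≤ L * K ^ 2 * (Real.exp (B * σ) - 1) ^ (2 * k) := by
  have := sqInt_le_of_norm_le hL (continuous_fwdDiff_iter σ hfc k)
    (fun t h0 ht => hf k σ hσ t h0 (ht.trans hLT))
  rw [mul_pow, ← pow_mul, mul_comm k 2, ← mul_assoc] at this
  exact this

/-- For small steps the difference multiplier at a frequency `ω` with `|ω| ≥ 2B` dominates the one
of the frequencies of modulus at most `B`. -/
theorem exp_sub_one_le_norm_exp_sub_one {ω : ℂ} {B σ : ℝ} (hB : 0 < B) (hω : 2 * B ≤ ‖ω‖)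
    (hσ : 0 < σ) (hσ' : 4 * (‖ω‖ * σ) ≤ 1) :
    0 < ‖exp (I * ω * σ) - 1‖ ∧
      Real.exp (B * σ) - 1 ≤ 3 / 4 * ‖exp (I * ω * σ) - 1‖ := by
  set x : ℝ := ‖ω‖ * σ with hx
  have hBσ : 0 < B * σ := by positivity
  have hBx : 2 * (B * σ) ≤ x := by rw [hx, ← mul_assoc]; gcongr
  have hnorm : ‖I * ω * σ‖ = x := by
    rw [norm_mul, norm_mul, norm_I, one_mul, norm_real, Real.norm_eq_abs, abs_of_pos hσ]
  have h1 := norm_exp_sub_one_sub_id_le (x := I * ω * σ) (by rw [hnorm]; linarith)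
  rw [hnorm] at h1
  have h2 : x ≤ ‖exp (I * ω * σ) - 1‖ + x ^ 2 := by
    have := norm_sub_norm_le (I * ω * σ) (exp (I * ω * σ) - 1)
    rw [norm_sub_rev (I * ω * σ), hnorm] at this
    linarith
  have h3 := (abs_le.1 (Real.abs_exp_sub_one_sub_id_le (x := B * σ)
    (by rw [abs_of_pos hBσ]; linarith))).2
  -- With `x = |ω|σ ≤ 1/4`, the right-hand multiplier is at least `x - x² ≥ 3x/4`, while `e^{Bσ} - 1
  -- ≤ x/2 + x²/4 ≤ 9x/16`. The quotient of the two bounds is exactly `3/4`.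
  constructor
  · nlinarith
  · nlinarith

/-- Exponentials with distinct exponents are linearly independent on every interval. -/
theorem eq_zero_of_sum_exp_eq_zero {ι : Type*} (s : Finset ι) (z : ι → ℂ)
    (hz : Set.InjOn z s) (b : ι → ℂ) {T : ℝ} (hT : 0 < T)
    (h : ∀ t : ℝ, 0 < t → t < T → ∑ i ∈ s, b i * exp (z i * t) = 0) : ∀ i ∈ s, b i = 0 := by
  have hall : ∀ t : ℝ, ∑ i ∈ s, b i * exp (z i * t) = 0 := by
    have han : AnalyticOnNhd ℝ (fun t : ℝ => ∑ i ∈ s, b i * exp (z i * t)) Set.univ := by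
      intro t _
      apply Finset.analyticAt_fun_sum
      intro i _
      have h1 : AnalyticAt ℝ (fun t : ℝ => (t : ℂ)) t := Complex.ofRealCLM.analyticAt t
      have h2 : AnalyticAt ℝ (fun t : ℝ => z i * (t : ℂ)) t := analyticAt_const.mul h1
      have h3 : AnalyticAt ℝ exp (z i * (t : ℂ)) := (analyticAt_cexp).restrictScalars
      exact analyticAt_const.mul (AnalyticAt.fun_comp (f := fun t : ℝ => z i * (t : ℂ)) h3 h2)
    have hev : (fun t : ℝ => ∑ i ∈ s, b i * exp (z i * t)) =ᶠ[𝓝 (T / 2)] 0 := by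
      filter_upwards [Ioo_mem_nhds (by linarith : (0 : ℝ) < T / 2) (by linarith : T / 2 < T)]
        with t ht using h t ht.1 ht.2
    intro t
    exact han.eqOn_zero_of_preconnected_of_eventuallyEq_zero isPreconnected_univ
      (Set.mem_univ (T / 2)) hev (Set.mem_univ t)
  -- Dedekind's independence of characters needs the relation on all of `ℝ`; analyticity has just
  -- provided it. Distinct exponents give distinct characters by differentiating at 0.
  let χ : ℂ → (Multiplicative ℝ →* ℂ) := fun w =>
    { toFun := fun t => exp (w * (Multiplicative.toAdd t : ℝ))
      map_one' := by simp
      map_mul' := fun x y => by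
        rw [toAdd_mul, ofReal_add, mul_add, exp_add] }
  have hχ : Function.Injective χ := by
    intro w w' hww
    have hfun : ∀ t : ℝ, exp (w * t) = exp (w' * t) := fun t =>
      DFunLike.congr_fun hww (Multiplicative.ofAdd t)
    have hd : ∀ w : ℂ, HasDerivAt (fun t : ℝ => exp (w * t)) w 0 := fun w => by
      have := ((hasDerivAt_id ((0 : ℝ) : ℂ)).const_mul w).cexp.comp_ofReal
      simpa using this
    have e : (fun t : ℝ => exp (w * t)) = fun t : ℝ => exp (w' * t) := funext hfun
    exact (hd w).unique (e ▸ hd w')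
  have hli := (linearIndependent_monoidHom (Multiplicative ℝ) ℂ).comp χ hχ
  have hli' : LinearIndependent ℂ (fun i : s => (χ (z i) : Multiplicative ℝ → ℂ)) :=
    hli.comp (fun i : s => z i) fun i j hij => Subtype.ext (hz i.2 j.2 hij)
  rw [Fintype.linearIndependent_iff] at hli'
  have h0 := hli' (fun i => b i) (by
    funext t
    rw [Finset.sum_apply, Pi.zero_apply, ← hall (Multiplicative.toAdd t)]
    exact Finset.sum_coe_sort s (fun i => b i * exp (z i * (Multiplicative.toAdd t : ℝ))))
  exact fun i hi => h0 ⟨i, hi⟩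

/-! ### The coupled system: Riesz and Bessel bounds -/

/-- The analytic hypotheses on the exponents and weights of the coupled system. The sequence `a`
controls the coefficients of the real exponentials. -/
structure ExponentialSystem (ω ζ : ℕ → ℂ) (r a : ℕ → ℝ) (c d : ℕ → ℂ) (γ α : ℝ) : Prop where
  γ_pos : 0 < γ
  gapω : liminf (fun n => (((ω (n + 1)).re - (ω n).re : ℝ) : EReal)) atTop = (γ : EReal)
  gapζ : liminf (fun n => (((ζ (n + 1)).re - (ζ n).re : ℝ) : EReal)) atTop = (γ : EReal)
  imω : Tendsto (fun n => (ω n).im) atTop (𝓝 α)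
  imζ : Tendsto (fun n => (ζ n).im) atTop (𝓝 0)
  c_tendsto : Tendsto c atTop (𝓝 0)
  d_inv_tendsto : Tendsto (fun n => (d n)⁻¹) atTop (𝓝 0)
  d_ne : ∀ n, d n ≠ 0
  r_bdd : ∃ B, ∀ n, |r n| ≤ B
  a_nonneg : ∀ n, 0 ≤ a n
  a_sq : Summable fun n => a n ^ 2

/-- The energy `|C_n|² + |d_n D_n|²`. -/
noncomputable def pairEnergy (d C D : ℕ → ℂ) (n : ℕ) : ℝ := ‖C n‖ ^ 2 + ‖d n * D n‖ ^ 2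

theorem pairEnergy_nonneg (d C D : ℕ → ℂ) (n : ℕ) : 0 ≤ pairEnergy d C D n := by
  unfold pairEnergy; positivity

/-- The part of `u₁` without the real exponentials. -/
noncomputable def oscPart₁ (ω ζ C D : ℕ → ℂ) (s : Finset ℕ) (t : ℝ) : ℂ :=
  pairSum s C ω t + pairSum s D ζ t

/-- The part of `u₂` without the real exponential. -/
noncomputable def oscPart₂ (ω ζ c d C D : ℕ → ℂ) (s : Finset ℕ) (t : ℝ) : ℂ :=
  pairSum s (fun n => d n * D n) ζ t + pairSum s (fun n => c n * C n) ω t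

/-- The part of `u₁` consisting of real exponentials. -/
noncomputable def realPart₁ (r R : ℕ → ℝ) (s : Finset ℕ) (t : ℝ) : ℂ :=
  ∑ n ∈ s, (R n : ℂ) * exp ((r n : ℂ) * t)

@[fun_prop]
theorem continuous_oscPart₁ (ω ζ C D : ℕ → ℂ) (s : Finset ℕ) :
    Continuous (oscPart₁ ω ζ C D s) := by
  unfold oscPart₁; fun_prop

@[fun_prop]
theorem continuous_oscPart₂ (ω ζ c d C D : ℕ → ℂ) (s : Finset ℕ) :
    Continuous (oscPart₂ ω ζ c d C D s) := by
  unfold oscPart₂; fun_prop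

@[fun_prop]
theorem continuous_realPart₁ (r R : ℕ → ℝ) (s : Finset ℕ) : Continuous (realPart₁ r R s) := by
  unfold realPart₁; fun_prop

theorem sum_firstTerm (ω ζ : ℕ → ℂ) (r : ℕ → ℝ) (C D : ℕ → ℂ) (R : ℕ → ℝ) (s : Finset ℕ)
    (t : ℝ) : ∑ n ∈ s, firstTerm ω ζ r C D R n t
      = oscPart₁ ω ζ C D s t + realPart₁ r R s t := by
  simp only [firstTerm, oscPart₁, realPart₁, pairSum, Finset.sum_add_distrib]
  ring

theorem sum_secondTerm (ω ζ c d C D : ℕ → ℂ) (s : Finset ℕ) (t : ℝ) :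
    ∑ n ∈ s, secondTerm ω ζ c d C D n t = oscPart₂ ω ζ c d C D s t := by
  simp only [secondTerm, oscPart₂, pairSum, Finset.sum_add_distrib]

theorem sqInt_half_sub_le {L : ℝ} (hL : 0 ≤ L) {f g : ℝ → ℂ} (hf : Continuous f)
    (hg : Continuous g) : sqInt L f / 2 - sqInt L g ≤ sqInt L (fun t => f t + g t) := by
  have := sqInt_sub_le hL (f := fun t => f t + g t) (g := g) (by fun_prop) hg
  simp only [add_sub_cancel_right] at this
  have e : sqInt L (fun t => f t) = sqInt L f := rfl
  linarith

namespace ExponentialSystem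

variable {ω ζ : ℕ → ℂ} {r a : ℕ → ℝ} {c d : ℕ → ℂ} {γ α : ℝ}

theorem norm_D_sq (h : ExponentialSystem ω ζ r a c d γ α) (D : ℕ → ℂ) (n : ℕ) :
    ‖D n‖ ^ 2 = ‖(d n)⁻¹‖ ^ 2 * ‖d n * D n‖ ^ 2 := by
  rw [← mul_pow, ← norm_mul, inv_mul_cancel_left₀ (h.d_ne n)]

/-- Far out, the cross terms `D_n` in `u₁` and `c_n C_n` in `u₂` are small multiples of the energy,
so the two components decouple and the scalar Riesz bounds apply to each. -/
theorem exists_lower (h : ExponentialSystem ω ζ r a c d γ α) {L : ℝ} (hL : 0 < L)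
    (hγL : 2 * Real.pi < γ * L) :
    ∃ N : ℕ, ∃ k > 0, ∀ s : Finset ℕ, (∀ n ∈ s, N ≤ n) → ∀ C D : ℕ → ℂ,
      k * ∑ n ∈ s, pairEnergy d C D n
        ≤ sqInt L (oscPart₁ ω ζ C D s) + sqInt L (oscPart₂ ω ζ c d C D s) := by
  obtain ⟨N₁, c₁, hc₁, h₁⟩ := exists_pairSum_lower hL h.gapω h.imω hγL
  obtain ⟨N₂, c₂, hc₂, h₂⟩ := exists_pairSum_lower hL h.gapζ h.imζ hγL
  obtain ⟨K₁, hK₁, h₃⟩ := exists_pairSum_upper hL h.γ_pos h.gapω h.imω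
  obtain ⟨K₂, hK₂, h₄⟩ := exists_pairSum_upper hL h.γ_pos h.gapζ h.imζ
  set k : ℝ := min c₁ c₂ with hk
  have hk0 : 0 < k := lt_min hc₁ hc₂
  have e₁ : Tendsto (fun n => K₁ * ‖c n‖ ^ 2) atTop (𝓝 0) := by
    simpa using (h.c_tendsto.norm.pow 2).const_mul K₁
  have e₂ : Tendsto (fun n => K₂ * ‖(d n)⁻¹‖ ^ 2) atTop (𝓝 0) := by
    simpa using (h.d_inv_tendsto.norm.pow 2).const_mul K₂
  obtain ⟨N₃, hN₃⟩ := eventually_atTop.1 ((e₁.eventually (gt_mem_nhds (by positivity : 0 < k / 4))).and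
    (e₂.eventually (gt_mem_nhds (by positivity : 0 < k / 4))))
  -- Removing the cross terms halves the main terms to `k/2`, and each cross term takes back at most
  -- `k/4`.
  refine ⟨max (max N₁ N₂) N₃, k / 4, by positivity, fun s hs C D => ?_⟩
  have hs₁ := h₁ s (fun n hn => (le_max_left _ _).trans (le_of_max_le_left (hs n hn))) C
  have hs₂ := h₂ s (fun n hn => (le_max_right _ _).trans (le_of_max_le_left (hs n hn)))
    (fun n => d n * D n)
  have hs₃ : sqInt L (pairSum s (fun n => c n * C n) ω) ≤ k / 4 * ∑ n ∈ s, ‖C n‖ ^ 2 := by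
    refine (h₃ s _).trans ?_
    rw [Finset.mul_sum, Finset.mul_sum]
    refine Finset.sum_le_sum fun n hn => ?_
    rw [norm_mul, mul_pow, ← mul_assoc]
    exact mul_le_mul_of_nonneg_right (hN₃ n (le_of_max_le_right (hs n hn))).1.le (by positivity)
  have hs₄ : sqInt L (pairSum s D ζ) ≤ k / 4 * ∑ n ∈ s, ‖d n * D n‖ ^ 2 := by
    refine (h₄ s _).trans ?_
    rw [Finset.mul_sum, Finset.mul_sum]
    refine Finset.sum_le_sum fun n hn => ?_
    rw [h.norm_D_sq, ← mul_assoc]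
    exact mul_le_mul_of_nonneg_right (hN₃ n (le_of_max_le_right (hs n hn))).2.le (by positivity)
  have t₁ := sqInt_half_sub_le hL.le (f := pairSum s C ω) (g := pairSum s D ζ)
    (by fun_prop) (by fun_prop)
  have t₂ := sqInt_half_sub_le hL.le (f := pairSum s (fun n => d n * D n) ζ)
    (g := pairSum s (fun n => c n * C n) ω) (by fun_prop) (by fun_prop)
  have p₁ : k * ∑ n ∈ s, ‖C n‖ ^ 2 ≤ c₁ * ∑ n ∈ s, ‖C n‖ ^ 2 := by
    gcongr
    exact min_le_left _ _
  have p₂ : k * ∑ n ∈ s, ‖d n * D n‖ ^ 2 ≤ c₂ * ∑ n ∈ s, ‖d n * D n‖ ^ 2 := by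
    gcongr
    exact min_le_right _ _
  simp only [pairEnergy, Finset.sum_add_distrib]
  change _ ≤ sqInt L (fun t => pairSum s C ω t + pairSum s D ζ t) +
    sqInt L (fun t => pairSum s (fun n => d n * D n) ζ t + pairSum s (fun n => c n * C n) ω t)
  linarith

theorem exists_osc_upper (h : ExponentialSystem ω ζ r a c d γ α) {L : ℝ} (hL : 0 < L) :
    ∃ K > 0, ∀ (s : Finset ℕ) (C D : ℕ → ℂ),
      sqInt L (oscPart₁ ω ζ C D s) + sqInt L (oscPart₂ ω ζ c d C D s)
        ≤ K * ∑ n ∈ s, pairEnergy d C D n := by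
  obtain ⟨K₁, hK₁, h₁⟩ := exists_pairSum_upper hL h.γ_pos h.gapω h.imω
  obtain ⟨K₂, hK₂, h₂⟩ := exists_pairSum_upper hL h.γ_pos h.gapζ h.imζ
  obtain ⟨B₁, hB₁⟩ := (Metric.isBounded_range_of_tendsto _ h.c_tendsto).exists_norm_le
  obtain ⟨B₂, hB₂⟩ := (Metric.isBounded_range_of_tendsto _ h.d_inv_tendsto).exists_norm_le
  refine ⟨2 * K₁ + 2 * (K₂ * B₂ ^ 2) + 2 * K₂ + 2 * (K₁ * B₁ ^ 2), by positivity,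
    fun s C D => ?_⟩
  have s₁ := h₁ s C
  have s₂ := h₂ s (fun n => d n * D n)
  have s₃ : sqInt L (pairSum s D ζ) ≤ K₂ * B₂ ^ 2 * ∑ n ∈ s, ‖d n * D n‖ ^ 2 := by
    refine (h₂ s _).trans ?_
    rw [mul_assoc, Finset.mul_sum (s := s) (a := B₂ ^ 2)]
    gcongr with n hn
    rw [h.norm_D_sq]
    gcongr
    exact hB₂ _ ⟨n, rfl⟩
  have s₄ : sqInt L (pairSum s (fun n => c n * C n) ω)
      ≤ K₁ * B₁ ^ 2 * ∑ n ∈ s, ‖C n‖ ^ 2 := by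
    refine (h₁ s _).trans ?_
    rw [mul_assoc, Finset.mul_sum (s := s) (a := B₁ ^ 2)]
    gcongr with n hn
    rw [norm_mul, mul_pow]
    gcongr
    exact hB₁ _ ⟨n, rfl⟩
  have t₁ := sqInt_add_le hL.le (f := pairSum s C ω) (g := pairSum s D ζ)
    (by fun_prop) (by fun_prop)
  have t₂ := sqInt_add_le hL.le (f := pairSum s (fun n => d n * D n) ζ)
    (g := pairSum s (fun n => c n * C n) ω) (by fun_prop) (by fun_prop)
  simp only [pairEnergy, Finset.sum_add_distrib]
  change sqInt L (fun t => pairSum s C ω t + pairSum s D ζ t) +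
    sqInt L (fun t => pairSum s (fun n => d n * D n) ζ t + pairSum s (fun n => c n * C n) ω t) ≤ _
  have q₁ : 0 ≤ ∑ n ∈ s, ‖C n‖ ^ 2 := Finset.sum_nonneg fun _ _ => by positivity
  have q₂ : 0 ≤ ∑ n ∈ s, ‖d n * D n‖ ^ 2 := Finset.sum_nonneg fun _ _ => by positivity
  have m₁ := mul_nonneg (by positivity : 0 ≤ K₂ + K₂ * B₂ ^ 2) q₁
  have m₂ := mul_nonneg (by positivity : 0 ≤ K₁ + K₁ * B₁ ^ 2) q₂
  linarith

/-- The coefficients of the real exponentials are controlled by the energy. -/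
theorem sum_abs_R_sq_le {d C D : ℕ → ℂ} {a R : ℕ → ℝ} {s : Finset ℕ}
    (hR : ∀ n ∈ s, |R n| ≤ a n * Real.sqrt (pairEnergy d C D n)) :
    (∑ n ∈ s, |R n|) ^ 2 ≤ (∑ n ∈ s, a n ^ 2) * ∑ n ∈ s, pairEnergy d C D n := by
  calc (∑ n ∈ s, |R n|) ^ 2 ≤ (∑ n ∈ s, a n * Real.sqrt (pairEnergy d C D n)) ^ 2 := by
        refine pow_le_pow_left₀ (Finset.sum_nonneg fun _ _ => abs_nonneg _) ?_ 2
        exact Finset.sum_le_sum hR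
    _ ≤ (∑ n ∈ s, a n ^ 2) * ∑ n ∈ s, Real.sqrt (pairEnergy d C D n) ^ 2 :=
        Finset.sum_mul_sq_le_sq_mul_sq _ _ _
    _ = _ := by
        simp_rw [Real.sq_sqrt (pairEnergy_nonneg d C D _)]

theorem norm_realPart₁_le {r R : ℕ → ℝ} {B T t : ℝ} (hB : ∀ n, |r n| ≤ B) (h0 : 0 ≤ t)
    (ht : t ≤ T) (s : Finset ℕ) :
    ‖realPart₁ r R s t‖ ≤ Real.exp (B * T) * ∑ n ∈ s, |R n| := by
  rw [Finset.mul_sum]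
  refine norm_sum_le_of_le _ fun n _ => ?_
  rw [norm_mul, mul_comm, norm_real, Real.norm_eq_abs, norm_exp]
  gcongr
  rw [← ofReal_mul, ofReal_re]
  have hB0 : 0 ≤ B := (abs_nonneg _).trans (hB n)
  calc r n * t ≤ B * t := by gcongr; exact (le_abs_self _).trans (hB n)
    _ ≤ B * T := by gcongr

/-- The real exponentials are uniformly bounded on the interval, so only `∑ |R_n|` matters, and
Cauchy–Schwarz against the square summable `a` controls it by the energy. -/
theorem exists_upper (h : ExponentialSystem ω ζ r a c d γ α) {L : ℝ} (hL : 0 < L) :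
    ∃ K > 0, ∀ (s : Finset ℕ) (C D : ℕ → ℂ) (R : ℕ → ℝ),
      (∀ n ∈ s, |R n| ≤ a n * Real.sqrt (pairEnergy d C D n)) →
      sqInt L (fun t => oscPart₁ ω ζ C D s t + realPart₁ r R s t)
        + sqInt L (oscPart₂ ω ζ c d C D s) ≤ K * ∑ n ∈ s, pairEnergy d C D n := by
  obtain ⟨K, hK, hosc⟩ := h.exists_osc_upper hL
  obtain ⟨B, hB⟩ := h.r_bdd
  have hA : 0 ≤ ∑' n, a n ^ 2 := tsum_nonneg fun _ => sq_nonneg _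
  refine ⟨2 * K + 2 * (L * Real.exp (B * L) ^ 2 * ∑' n, a n ^ 2), by positivity,
    fun s C D R hR => ?_⟩
  have h1 := hosc s C D
  have h2 := sqInt_add_le hL.le (f := oscPart₁ ω ζ C D s) (g := realPart₁ r R s)
    (by fun_prop) (by fun_prop)
  have h3 := sqInt_le_of_norm_le hL.le (f := realPart₁ r R s) (by fun_prop)
    (fun t h0 ht => norm_realPart₁_le hB h0 ht s)
  have hE : 0 ≤ ∑ n ∈ s, pairEnergy d C D n := Finset.sum_nonneg fun n _ => pairEnergy_nonneg _ _ _ _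
  have h4 : (∑ n ∈ s, |R n|) ^ 2 ≤ (∑' n, a n ^ 2) * ∑ n ∈ s, pairEnergy d C D n :=
    (sum_abs_R_sq_le hR).trans (mul_le_mul_of_nonneg_right
      (h.a_sq.sum_le_tsum s fun _ _ => sq_nonneg _) hE)
  have h5 : L * (Real.exp (B * L) * ∑ n ∈ s, |R n|) ^ 2
      ≤ L * Real.exp (B * L) ^ 2 * ((∑' n, a n ^ 2) * ∑ n ∈ s, pairEnergy d C D n) := by
    rw [mul_pow, ← mul_assoc]
    gcongr
  have h6 := sqInt_nonneg hL.le (oscPart₂ ω ζ c d C D s)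
  linarith

theorem tendsto_norm_atTop {ω : ℕ → ℂ} {γ : ℝ} (hγ : 0 < γ)
    (h : liminf (fun n => (((ω (n + 1)).re - (ω n).re : ℝ) : EReal)) atTop = (γ : EReal)) :
    Tendsto (fun n => ‖ω n‖) atTop atTop := by
  obtain ⟨N, -, hN⟩ := exists_gap_of_liminf h (half_lt_self hγ)
  have h1 : Tendsto (fun n : ℕ => γ / 2 * (n : ℝ)) atTop atTop :=
    tendsto_natCast_atTop_atTop.const_mul_atTop (half_pos hγ)
  refine tendsto_atTop_mono' _ ?_ h1
  filter_upwards [eventually_ge_atTop N] with n hn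
  have := (hN n hn).trans ((le_abs_self _).trans (abs_re_le_norm (ω n)))
  linarith

end ExponentialSystem

/-! ### Decay of single high-frequency coefficients -/

theorem diffBound_pairSum {T B K : ℝ} {ω a : ℕ → ℂ} {s : Finset ℕ} (hω : ∀ n ∈ s, ‖ω n‖ ≤ B)
    {N : ℕ} (hs : s ⊆ Finset.range N) (hB : 0 ≤ B) (hK : 0 ≤ K) (ha : ∀ n ∈ s, ‖a n‖ ≤ K) :
    DiffBound T B (N * (2 * K * Real.exp (B * T))) (pairSum s a ω) := by
  have h := DiffBound.sum (T := T) (B := B) (s := s) (K := fun n => 2 * ‖a n‖ * Real.exp (B * T))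
    (f := fun n => conjPairExp (a n) (ω n)) (fun n hn => diffBound_conjPairExp (hω n hn))
  refine DiffBound.mono hB h ?_
  calc _ ≤ ∑ _n ∈ s, 2 * K * Real.exp (B * T) := by
        refine Finset.sum_le_sum fun n hn => ?_
        have := ha n hn
        gcongr
    _ = (s.card : ℝ) * (2 * K * Real.exp (B * T)) := by simp
    _ ≤ _ := by
        gcongr
        simpa using Finset.card_le_card hs

theorem diffBound_realPart₁ {T B : ℝ} {r R : ℕ → ℝ} (hB : ∀ n, |r n| ≤ B) (s : Finset ℕ) :
    DiffBound T B ((∑ n ∈ s, |R n|) * Real.exp (B * T)) (realPart₁ r R s) := by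
  have h := DiffBound.sum (T := T) (B := B) (s := s) (K := fun n => |R n| * Real.exp (B * T))
    (f := fun n (t : ℝ) => (R n : ℂ) * exp ((r n : ℂ) * t)) (fun n _ => by
      have := diffBound_exp (T := T) (B := B) (b := (R n : ℂ)) (z := (r n : ℂ))
        (by simpa using hB n)
      simpa using this)
  rw [← Finset.sum_mul] at h
  exact h

/-- Write `f = u - g`: differences of the signal `u` are paid for by `4^k`, those of the remainder
`g` are geometrically small. -/
theorem sqInt_fwdDiff_iter_le_of_add {T L B K σ : ℝ} {f g u : ℝ → ℂ} (hL : 0 ≤ L) (hLT : L ≤ T)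
    (hσ : 0 ≤ σ) {k : ℕ} (hk : L + k * σ = T) (hf : Continuous f) (hg : Continuous g)
    (hgB : DiffBound T B K g) (hu : u = fun t => f t + g t) :
    sqInt L ((fwdDiff σ)^[k] f)
      ≤ 2 * (4 ^ k * sqInt T u) + 2 * (L * K ^ 2 * (Real.exp (B * σ) - 1) ^ (2 * k)) := by
  have huc : Continuous u := by rw [hu]; fun_prop
  have e : (fwdDiff σ)^[k] f = fun t => (fwdDiff σ)^[k] u t - (fwdDiff σ)^[k] g t := by
    have : u = f + g := hu
    rw [this, fwdDiff_iter_add]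
    funext t
    simp
  have h1 := sqInt_sub_le hL (continuous_fwdDiff_iter σ huc k) (continuous_fwdDiff_iter σ hg k)
  have h2 := sqInt_fwdDiff_iter_le hL hσ huc k
  rw [hk] at h2
  have h3 := hgB.sqInt_le hg hL hLT hσ k
  rw [e]
  linarith

theorem pairSum_filter_add (s : Finset ℕ) (p : ℕ → Prop) [DecidablePred p] (a ω : ℕ → ℂ) (t : ℝ) :
    pairSum s a ω t = pairSum (s.filter p) a ω t + pairSum (s.filter fun n => ¬ p n) a ω t :=
  (Finset.sum_filter_add_sum_filter_not s _ _).symm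

theorem oscPart₁_filter_add (ω ζ C D : ℕ → ℂ) (s : Finset ℕ) (p : ℕ → Prop) [DecidablePred p]
    (t : ℝ) : oscPart₁ ω ζ C D s t
      = oscPart₁ ω ζ C D (s.filter p) t + oscPart₁ ω ζ C D (s.filter fun n => ¬ p n) t := by
  unfold oscPart₁
  rw [pairSum_filter_add s p, pairSum_filter_add s p]
  ring

theorem oscPart₂_filter_add (ω ζ c d C D : ℕ → ℂ) (s : Finset ℕ) (p : ℕ → Prop)
    [DecidablePred p] (t : ℝ) : oscPart₂ ω ζ c d C D s t
      = oscPart₂ ω ζ c d C D (s.filter p) t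
        + oscPart₂ ω ζ c d C D (s.filter fun n => ¬ p n) t := by
  unfold oscPart₂
  rw [pairSum_filter_add s p, pairSum_filter_add s p]
  ring

namespace ExponentialSystem

variable {ω ζ : ℕ → ℂ} {r a : ℕ → ℝ} {c d : ℕ → ℂ} {γ α : ℝ}

/-- Quantitative smallness of a single high-frequency coefficient, by iterated differences. -/
theorem exists_coeff_bound (h : ExponentialSystem ω ζ r a c d γ α) (η M : ℝ) {L τ : ℝ} (hL : 0 < L)
    (hτ : 0 < τ) (hγL : 2 * Real.pi < γ * L) :
    ∃ N : ℕ, ∃ K B : ℝ, 0 < K ∧ 0 < B ∧ ∀ (S : ℕ) (C D : ℕ → ℂ) (R : ℕ → ℝ) (E : ℝ),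
      (∀ n, |R n| ≤ a n * Real.sqrt (pairEnergy d C D n)) →
      ∑ n ∈ Finset.range S, pairEnergy d C D n ≤ 1 → |E| ≤ M →
      ∀ (k : ℕ) (σ : ℝ), 0 ≤ σ → k * σ = τ → ∀ n, N ≤ n → n < S →
        ‖C n‖ ^ 2 * ‖exp (I * ω n * σ) - 1‖ ^ (2 * k)
          + ‖d n * D n‖ ^ 2 * ‖exp (I * ζ n * σ) - 1‖ ^ (2 * k)
        ≤ K * (4 ^ k * (sqInt (L + τ) (fun t => oscPart₁ ω ζ C D (Finset.range S) t
              + realPart₁ r R (Finset.range S) t)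
            + sqInt (L + τ) (fun t => oscPart₂ ω ζ c d C D (Finset.range S) t
              + E * exp (-(η : ℂ) * t)))
          + (Real.exp (B * σ) - 1) ^ (2 * k)) := by
  obtain ⟨N, κ, hκ, hlow⟩ := h.exists_lower hL hγL
  obtain ⟨B₀, hB₀⟩ := h.r_bdd
  obtain ⟨B₁, hB₁⟩ := (Metric.isBounded_range_of_tendsto _ h.c_tendsto).exists_norm_le
  obtain ⟨B₂, hB₂⟩ := (Metric.isBounded_range_of_tendsto _ h.d_inv_tendsto).exists_norm_le
  have hB₁0 : 0 ≤ B₁ := (norm_nonneg _).trans (hB₁ _ ⟨0, rfl⟩)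
  have hB₂0 : 0 ≤ B₂ := (norm_nonneg _).trans (hB₂ _ ⟨0, rfl⟩)
  have hB₀0 : 0 ≤ B₀ := (abs_nonneg _).trans (hB₀ 0)
  -- `B` dominates the modulus of every exponent outside the Riesz tail: all `r_n`, `-η`, and the
  -- finitely many low oscillating ones.
  set B : ℝ := 1 + B₀ + |η| + ∑ n ∈ Finset.range N, (‖ω n‖ + ‖ζ n‖) with hB
  have hsum0 : 0 ≤ ∑ n ∈ Finset.range N, (‖ω n‖ + ‖ζ n‖) :=
    Finset.sum_nonneg fun _ _ => by positivity
  have hBpos : 0 < B := by positivity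
  have hBN : ∀ n < N, ‖ω n‖ + ‖ζ n‖ ≤ B := by
    intro n hn
    have := Finset.single_le_sum (f := fun n => ‖ω n‖ + ‖ζ n‖) (s := Finset.range N)
      (fun _ _ => by positivity) (Finset.mem_range.2 hn)
    have hη := abs_nonneg η
    linarith
  set T : ℝ := L + τ with hT
  set e : ℝ := Real.exp (B * T) with he
  set A : ℝ := ∑' n, a n ^ 2 with hA
  set K₁ : ℝ := N * (2 * 1 * e) + N * (2 * B₂ * e) + Real.sqrt A * e with hK₁
  set K₂ : ℝ := N * (2 * 1 * e) + N * (2 * B₁ * e) + M * e with hK₂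
  refine ⟨N, (2 + 2 * (L * K₁ ^ 2) + 2 * (L * K₂ ^ 2)) / κ, B, by positivity, hBpos, ?_⟩
  intro S C D R E hR hE hEM k σ hσ hkσ n hn hnS
  set s := Finset.range S with hs
  set s₁ := s.filter (fun n => N ≤ n) with hs₁
  set s₂ := s.filter (fun n => ¬ N ≤ n) with hs₂
  have hs₂N : s₂ ⊆ Finset.range N := fun m hm => by
    have := (Finset.mem_filter.1 hm).2
    simp only [Finset.mem_range]; omega
  have hen : ∀ m ∈ s, pairEnergy d C D m ≤ 1 := fun m hm =>
    (Finset.single_le_sum (f := pairEnergy d C D) (fun _ _ => pairEnergy_nonneg d C D _) hm).trans hE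
  have hC1 : ∀ m ∈ s, ‖C m‖ ≤ 1 := fun m hm => by
    have := hen m hm
    unfold pairEnergy at this
    nlinarith [sq_nonneg ‖d m * D m‖, norm_nonneg (C m)]
  have hD1 : ∀ m ∈ s, ‖d m * D m‖ ≤ 1 := fun m hm => by
    have := hen m hm
    unfold pairEnergy at this
    nlinarith [sq_nonneg ‖C m‖, norm_nonneg (d m * D m)]
  have hD2 : ∀ m ∈ s, ‖D m‖ ≤ B₂ := fun m hm => by
    rw [← inv_mul_cancel_left₀ (h.d_ne m) (D m), norm_mul]
    calc _ ≤ B₂ * 1 := mul_le_mul (hB₂ _ ⟨m, rfl⟩) (hD1 m hm) (norm_nonneg _) hB₂0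
      _ = B₂ := mul_one _
  have hcC : ∀ m ∈ s, ‖c m * C m‖ ≤ B₁ := fun m hm => by
    rw [norm_mul]
    calc _ ≤ B₁ * 1 := mul_le_mul (hB₁ _ ⟨m, rfl⟩) (hC1 m hm) (norm_nonneg _) hB₁0
      _ = B₁ := mul_one _
  have hω₂ : ∀ m ∈ s₂, ‖ω m‖ ≤ B := fun m hm =>
    (le_add_of_nonneg_right (norm_nonneg _)).trans (hBN m (Finset.mem_range.1 (hs₂N hm)))
  have hζ₂ : ∀ m ∈ s₂, ‖ζ m‖ ≤ B := fun m hm =>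
    (le_add_of_nonneg_left (norm_nonneg _)).trans (hBN m (Finset.mem_range.1 (hs₂N hm)))
  have hsub : ∀ m ∈ s₂, m ∈ s := fun m hm => (Finset.mem_filter.1 hm).1
  have hRsum : ∑ m ∈ s, |R m| ≤ Real.sqrt A := by
    apply Real.le_sqrt_of_sq_le
    refine (sum_abs_R_sq_le (d := d) (C := C) (D := D) (a := a) fun m _ => hR m).trans ?_
    calc _ ≤ A * 1 := mul_le_mul (h.a_sq.sum_le_tsum s fun _ _ => sq_nonneg _) hE
          (Finset.sum_nonneg fun _ _ => pairEnergy_nonneg _ _ _ _)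
          (tsum_nonneg fun _ => sq_nonneg _)
      _ = A := mul_one _
  have hrB : ∀ m, |r m| ≤ B := fun m => by
    have := hB₀ m
    have hη := abs_nonneg η
    linarith
  have hrest₁ : DiffBound T B K₁ (fun t => oscPart₁ ω ζ C D s₂ t + realPart₁ r R s t) := by
    refine ((diffBound_pairSum hω₂ hs₂N hBpos.le zero_le_one fun m hm => hC1 m (hsub m hm)).add
      (diffBound_pairSum hζ₂ hs₂N hBpos.le hB₂0 fun m hm => hD2 m (hsub m hm))).add
      ((diffBound_realPart₁ hrB s).mono hBpos.le ?_)
    gcongr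
  have hrest₂ : DiffBound T B K₂
      (fun t => oscPart₂ ω ζ c d C D s₂ t + E * exp (-(η : ℂ) * t)) := by
    refine ((diffBound_pairSum hζ₂ hs₂N hBpos.le zero_le_one fun m hm => hD1 m (hsub m hm)).add
      (diffBound_pairSum hω₂ hs₂N hBpos.le hB₁0 fun m hm => hcC m (hsub m hm))).add
      ((diffBound_exp (z := -(η : ℂ)) ?_).mono hBpos.le ?_)
    · rw [norm_neg, norm_real, Real.norm_eq_abs]
      linarith
    · rw [norm_real, Real.norm_eq_abs]
      gcongr
  have hLT : L ≤ T := by linarith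
  have hkσ' : L + k * σ = T := by rw [hkσ]
  have b₁ := sqInt_fwdDiff_iter_le_of_add hL.le hLT hσ hkσ' (f := oscPart₁ ω ζ C D s₁)
    (by fun_prop) (by fun_prop) hrest₁ rfl
  have b₂ := sqInt_fwdDiff_iter_le_of_add hL.le hLT hσ hkσ' (f := oscPart₂ ω ζ c d C D s₁)
    (by fun_prop) (by fun_prop) hrest₂ rfl
  have u₁eq : (fun t => oscPart₁ ω ζ C D s₁ t + (oscPart₁ ω ζ C D s₂ t + realPart₁ r R s t))
      = fun t => oscPart₁ ω ζ C D s t + realPart₁ r R s t := by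
    funext t
    rw [oscPart₁_filter_add ω ζ C D s (fun n => N ≤ n), add_assoc]
  have u₂eq : (fun t : ℝ => oscPart₂ ω ζ c d C D s₁ t
        + (oscPart₂ ω ζ c d C D s₂ t + E * exp (-(η : ℂ) * t)))
      = fun t : ℝ => oscPart₂ ω ζ c d C D s t + E * exp (-(η : ℂ) * t) := by
    funext t
    rw [oscPart₂_filter_add ω ζ c d C D s (fun n => N ≤ n), add_assoc]
  rw [u₁eq] at b₁
  rw [u₂eq] at b₂
  -- The multiplier depends only on the exponent, so the differenced tail is again a coupled sum
  -- with the same `c` and `d`, and the Riesz bound applies to it.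
  set C' : ℕ → ℂ := fun n => C n * (exp (I * ω n * σ) - 1) ^ k with hC'
  set D' : ℕ → ℂ := fun n => D n * (exp (I * ζ n * σ) - 1) ^ k with hD'
  have d₁ : (fwdDiff σ)^[k] (oscPart₁ ω ζ C D s₁) = oscPart₁ ω ζ C' D' s₁ := by
    have : oscPart₁ ω ζ C D s₁ = pairSum s₁ C ω + pairSum s₁ D ζ := rfl
    rw [this, fwdDiff_iter_add, fwdDiff_iter_pairSum, fwdDiff_iter_pairSum]
    rfl
  have d₂ : (fwdDiff σ)^[k] (oscPart₂ ω ζ c d C D s₁) = oscPart₂ ω ζ c d C' D' s₁ := by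
    have : oscPart₂ ω ζ c d C D s₁
        = pairSum s₁ (fun n => d n * D n) ζ + pairSum s₁ (fun n => c n * C n) ω := rfl
    rw [this, fwdDiff_iter_add, fwdDiff_iter_pairSum, fwdDiff_iter_pairSum]
    funext t
    simp only [Pi.add_apply, oscPart₂, hC', hD', mul_assoc]
  rw [d₁] at b₁
  rw [d₂] at b₂
  have hl := hlow s₁ (fun m hm => (Finset.mem_filter.1 hm).2) C' D'
  have hsingle := Finset.single_le_sum (f := pairEnergy d C' D') (s := s₁)
    (fun _ _ => pairEnergy_nonneg d C' D' _)
    (Finset.mem_filter.2 ⟨Finset.mem_range.2 hnS, hn⟩ : n ∈ s₁)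
  have hval : pairEnergy d C' D' n = ‖C n‖ ^ 2 * ‖exp (I * ω n * σ) - 1‖ ^ (2 * k)
          + ‖d n * D n‖ ^ 2 * ‖exp (I * ζ n * σ) - 1‖ ^ (2 * k) := by
    simp only [pairEnergy, hC', hD', norm_mul, norm_pow]
    ring
  rw [← hval, div_mul_eq_mul_div, le_div_iff₀ hκ]
  have hmul := mul_le_mul_of_nonneg_left hsingle hκ.le
  set J₁ := sqInt T (fun t => oscPart₁ ω ζ C D s t + realPart₁ r R s t)
  set J₂ := sqInt T (fun t => oscPart₂ ω ζ c d C D s t + E * exp (-(η : ℂ) * t))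
  set q := (Real.exp (B * σ) - 1) ^ (2 * k)
  have hq : 0 ≤ q := by
    simp only [q, pow_mul]
    positivity
  have hT0 : 0 ≤ T := by positivity
  have hJ : 0 ≤ (4 : ℝ) ^ k * (J₁ + J₂) :=
    mul_nonneg (by positivity) (add_nonneg (sqInt_nonneg hT0 _) (sqInt_nonneg hT0 _))
  have x₁ : 0 ≤ L * K₁ ^ 2 := by positivity
  have x₂ : 0 ≤ L * K₂ ^ 2 := by positivity
  have y₁ := mul_nonneg (add_nonneg x₁ x₂) hJ
  linarith

/-- If the signals tend to zero while the energy stays bounded, every fixed high-frequency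
coefficient tends to zero. -/
theorem exists_tendsto_coeff (h : ExponentialSystem ω ζ r a c d γ α) (η M : ℝ) {T : ℝ} (hT : 0 < T)
    (hγT : 2 * Real.pi < γ * T) :
    ∃ N : ℕ, ∀ (S : ℕ → ℕ) (C D : ℕ → ℕ → ℂ) (R : ℕ → ℕ → ℝ) (E : ℕ → ℝ),
      (∀ j n, |R j n| ≤ a n * Real.sqrt (pairEnergy d (C j) (D j) n)) →
      (∀ j n, S j ≤ n → pairEnergy d (C j) (D j) n = 0) →
      (∀ j, ∑ n ∈ Finset.range (S j), pairEnergy d (C j) (D j) n ≤ 1) → (∀ j, |E j| ≤ M) →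
      Tendsto (fun j => sqInt T (fun t => oscPart₁ ω ζ (C j) (D j) (Finset.range (S j)) t
              + realPart₁ r (R j) (Finset.range (S j)) t)
            + sqInt T (fun t => oscPart₂ ω ζ c d (C j) (D j) (Finset.range (S j)) t
              + E j * exp (-(η : ℂ) * t))) atTop (𝓝 0) →
      ∀ n, N ≤ n → Tendsto (fun j => pairEnergy d (C j) (D j) n) atTop (𝓝 0) := by
  have hγ := h.γ_pos
  -- `L` is still long enough for the Riesz bound, and `T - L` is the room in which the `k`
  -- differences of step `(T - L)/k` are taken.
  obtain ⟨L, hL1, hL2⟩ := exists_between ((div_lt_iff₀' hγ).2 hγT)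
  have hL : 0 < L := lt_trans (by positivity) hL1
  rw [div_lt_iff₀' hγ] at hL1
  obtain ⟨N₀, K, B, hK, hB, hbound⟩ := h.exists_coeff_bound η M hL (sub_pos.2 hL2) hL1
  rw [add_sub_cancel] at hbound
  obtain ⟨N₁, hN₁⟩ := eventually_atTop.1
    (((tendsto_norm_atTop hγ h.gapω).eventually_ge_atTop (2 * B)).and
      ((tendsto_norm_atTop hγ h.gapζ).eventually_ge_atTop (2 * B)))
  refine ⟨max N₀ N₁, fun S C D R E hR hS hE hEM hJ n hn => ?_⟩
  obtain ⟨hωn, hζn⟩ := hN₁ n (le_of_max_le_right hn)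
  set τ := T - L with hτ
  have hτ0 : 0 < τ := sub_pos.2 hL2
  have hJ0 : ∀ j, 0 ≤ sqInt T (fun t => oscPart₁ ω ζ (C j) (D j) (Finset.range (S j)) t
              + realPart₁ r (R j) (Finset.range (S j)) t)
            + sqInt T (fun t => oscPart₂ ω ζ c d (C j) (D j) (Finset.range (S j)) t
              + E j * exp (-(η : ℂ) * t)) :=
    fun j => add_nonneg (sqInt_nonneg hT.le _) (sqInt_nonneg hT.le _)
  rw [Metric.tendsto_atTop]
  intro ε hε
  have hgeo : Tendsto (fun k : ℕ => K * ((3 / 4 : ℝ) ^ 2) ^ k) atTop (𝓝 0) := by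
    simpa using (tendsto_pow_atTop_nhds_zero_of_lt_one (by norm_num)
      (by norm_num : (3 / 4 : ℝ) ^ 2 < 1)).const_mul K
  obtain ⟨k₀, hk₀⟩ := exists_nat_ge (4 * (‖ω n‖ + ‖ζ n‖) * τ)
  -- The order of choices matters: `k` is fixed first, large enough for the geometric remainder and
  -- for small steps at this `n`; only then is `j` taken so large that `4^k` times the signal is
  -- small.
  obtain ⟨k, hk1, hk2⟩ := ((hgeo.eventually (gt_mem_nhds (by positivity : 0 < ε / 4))).and
    (eventually_ge_atTop (k₀ + 1))).exists
  have hkpos : (0 : ℝ) < k := by exact_mod_cast (by omega : 0 < k)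
  set σ := τ / k with hσ
  have hσ0 : 0 < σ := by positivity
  have hkσ : k * σ = τ := by rw [hσ]; field_simp
  have hkk : 4 * (‖ω n‖ + ‖ζ n‖) * τ ≤ k :=
    hk₀.trans (by exact_mod_cast (by omega : k₀ ≤ k))
  have hsmall : 4 * ((‖ω n‖ + ‖ζ n‖) * σ) ≤ 1 := by
    rw [hσ, ← mul_div_assoc, ← mul_div_assoc, div_le_one hkpos]
    linarith
  have hz₁ := exp_sub_one_le_norm_exp_sub_one hB hωn hσ0
    (by nlinarith [mul_nonneg (norm_nonneg (ζ n)) hσ0.le])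
  have hz₂ := exp_sub_one_le_norm_exp_sub_one hB hζn hσ0
    (by nlinarith [mul_nonneg (norm_nonneg (ω n)) hσ0.le])
  set ρ : ℝ := min ‖exp (I * ω n * σ) - 1‖ ‖exp (I * ζ n * σ) - 1‖ with hρ
  have hρ0 : 0 < ρ := lt_min hz₁.1 hz₂.1
  have hβ : Real.exp (B * σ) - 1 ≤ 3 / 4 * ρ := by
    rcases min_choice ‖exp (I * ω n * σ) - 1‖ ‖exp (I * ζ n * σ) - 1‖ with e | e
    · rw [hρ, e]; exact hz₁.2
    · rw [hρ, e]; exact hz₂.2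
  have hβ0 : 0 ≤ Real.exp (B * σ) - 1 := by
    rw [sub_nonneg]; exact Real.one_le_exp (by positivity)
  have hlim := hJ.const_mul (K * 4 ^ k / ρ ^ (2 * k))
  rw [mul_zero] at hlim
  obtain ⟨j₀, hj₀⟩ := eventually_atTop.1 (hlim.eventually (gt_mem_nhds (by positivity : 0 < ε / 4)))
  refine ⟨j₀, fun j hj => ?_⟩
  rw [Real.dist_eq, sub_zero, abs_of_nonneg (pairEnergy_nonneg _ _ _ _)]
  rcases le_or_gt (S j) n with hSn | hSn
  · rw [hS j n hSn]; exact hε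
  have hb := hbound (S j) (C j) (D j) (R j) (E j) (hR j) (hE j) (hEM j) k σ hσ0.le hkσ n
    (le_of_max_le_left hn) hSn
  have hj := hj₀ j hj
  set J := sqInt T (fun t => oscPart₁ ω ζ (C j) (D j) (Finset.range (S j)) t
              + realPart₁ r (R j) (Finset.range (S j)) t)
            + sqInt T (fun t => oscPart₂ ω ζ c d (C j) (D j) (Finset.range (S j)) t
              + E j * exp (-(η : ℂ) * t))
  have hlow : pairEnergy d (C j) (D j) n * ρ ^ (2 * k) ≤
      ‖C j n‖ ^ 2 * ‖exp (I * ω n * σ) - 1‖ ^ (2 * k)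
          + ‖d n * D j n‖ ^ 2 * ‖exp (I * ζ n * σ) - 1‖ ^ (2 * k) := by
    rw [pairEnergy, add_mul]
    gcongr
    · exact min_le_left _ _
    · exact min_le_right _ _
  have hq : (Real.exp (B * σ) - 1) ^ (2 * k) ≤ ((3 / 4 : ℝ) ^ 2) ^ k * ρ ^ (2 * k) := by
    rw [← pow_mul, ← mul_pow]
    gcongr
  have hρk : 0 < ρ ^ (2 * k) := by positivity
  have hfin : pairEnergy d (C j) (D j) n * ρ ^ (2 * k) ≤
      (K * 4 ^ k / ρ ^ (2 * k) * J + K * ((3 / 4 : ℝ) ^ 2) ^ k) * ρ ^ (2 * k) := by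
    calc _ ≤ K * (4 ^ k * J + (Real.exp (B * σ) - 1) ^ (2 * k)) := hlow.trans hb
      _ ≤ K * (4 ^ k * J + ((3 / 4 : ℝ) ^ 2) ^ k * ρ ^ (2 * k)) := by gcongr
      _ = _ := by field_simp
  have := le_of_mul_le_mul_right hfin hρk
  linarith

end ExponentialSystem

/-! ### Uniqueness for finite sums and limits of coefficients -/

/-- The exponents in `u₁`, indexed by `ℕ × Fin 5`. -/
noncomputable def exponent₁ (ω ζ : ℕ → ℂ) (r : ℕ → ℝ) (i : ℕ × Fin 5) : ℂ :=
  ![I * ω i.1, -I * conj (ω i.1), I * ζ i.1, -I * conj (ζ i.1), (r i.1 : ℂ)] i.2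

/-- Comparisons of two conjugated exponents, or of a conjugated one with some `r_n`, reduce by
conjugation to the unconjugated case because `r_n` is real. -/
theorem exponent₁_injective {ω ζ : ℕ → ℂ} {r : ℕ → ℝ} (hω : Function.Injective ω)
    (hζ : Function.Injective ζ) (hr : Function.Injective r) (hωζ : ∀ n m, ω n ≠ ζ m)
    (hrω : ∀ n m, (r n : ℂ) ≠ I * ω m) (hrζ : ∀ n m, (r n : ℂ) ≠ I * ζ m)
    (hωω : ∀ n m, ω n ≠ -conj (ω m)) (hζζ : ∀ n m, ζ n ≠ -conj (ζ m))
    (hωζ' : ∀ n m, ω n ≠ -conj (ζ m)) : Function.Injective (exponent₁ ω ζ r) := by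
  have cancel : ∀ {x y : ℂ}, I * x = I * y → x = y := fun h => mul_left_cancel₀ I_ne_zero h
  have cancel' : ∀ {x y : ℂ}, I * x = -I * conj y → x = -conj y := fun {x y} h =>
    cancel (by rw [h]; ring)
  have cancelc : ∀ {x y : ℂ}, -I * conj x = -I * conj y → x = y := fun {x y} h =>
    (starRingEnd ℂ).injective (mul_left_cancel₀ (neg_ne_zero.2 I_ne_zero) h)
  have real : ∀ {x : ℂ} {y : ℝ}, -I * conj x = (y : ℂ) → (y : ℂ) = I * x := fun {x y} h => by
    have := congrArg conj h
    simpa using this.symm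
  have hne : ∀ i j : Fin 5, i < j → ∀ n m, exponent₁ ω ζ r (n, i) ≠ exponent₁ ω ζ r (m, j) := by
    intro i j hij n m h
    fin_cases i <;> fin_cases j <;> first
      | exact absurd hij (by decide)
      | skip
    · exact hωω n m (cancel' h)
    · exact hωζ n m (cancel h)
    · exact hωζ' n m (cancel' h)
    · exact hrω m n h.symm
    · have h' : ζ m = -conj (ω n) := cancel' h.symm
      exact hωζ' n m (by rw [h']; simp)
    · exact hωζ n m (cancelc h)
    · exact hrω m n (real h)
    · exact hζζ n m (cancel' h)
    · exact hrζ m n h.symm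
    · exact hrζ m n (real h)
  rintro ⟨n, i⟩ ⟨m, j⟩ h
  rcases lt_trichotomy i j with hij | rfl | hij
  · exact absurd h (hne i j hij n m)
  · have : n = m := by
      fin_cases i
      · exact hω (cancel h)
      · exact hω (cancelc h)
      · exact hζ (cancel h)
      · exact hζ (cancelc h)
      · exact hr (ofReal_injective h)
    rw [this]
  · exact absurd h.symm (hne j i hij m n)

/-- The first signal alone determines `C` and `D`, so the exponent `-η` never has to be separated
from the others. -/
theorem coeff_eq_zero_of_vanishing {ω ζ : ℕ → ℂ} {r : ℕ → ℝ}
    (hinj : Function.Injective (exponent₁ ω ζ r)) {s : Finset ℕ} {C D : ℕ → ℂ} {R : ℕ → ℝ}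
    {T : ℝ} (hT : 0 < T)
    (h0 : ∀ t, 0 < t → t < T → oscPart₁ ω ζ C D s t + realPart₁ r R s t = 0) :
    ∀ n ∈ s, C n = 0 ∧ D n = 0 := by
  set b : ℕ × Fin 5 → ℂ := fun i => ![C i.1, conj (C i.1), D i.1, conj (D i.1), (R i.1 : ℂ)] i.2
  have key := eq_zero_of_sum_exp_eq_zero (s ×ˢ (Finset.univ : Finset (Fin 5))) (exponent₁ ω ζ r)
    hinj.injOn b hT (fun t ht ht' => by
      rw [← h0 t ht ht', Finset.sum_product]
      simp only [oscPart₁, realPart₁, pairSum, conjPairExp, ← Finset.sum_add_distrib]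
      refine Finset.sum_congr rfl fun n _ => ?_
      rw [Fin.sum_univ_five]
      simp only [exponent₁, b, Matrix.cons_val]
      ring)
  exact fun n hn => ⟨key (n, 0) (Finset.mk_mem_product hn (Finset.mem_univ _)),
    key (n, 2) (Finset.mk_mem_product hn (Finset.mem_univ _))⟩

theorem eq_zero_of_sqInt_eq_zero {T : ℝ} {f : ℝ → ℂ} (hf : Continuous f)
    (h : sqInt T f = 0) : ∀ t, 0 < t → t < T → f t = 0 := by
  intro t h0 ht
  by_contra hne
  have := intervalIntegral.integral_pos (h0.trans ht) (f := fun t => ‖f t‖ ^ 2)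
    (by fun_prop) (fun _ _ => by positivity) ⟨t, ⟨h0.le, ht.le⟩, by positivity⟩
  exact this.ne' h

theorem pairSum_eq_of_subset {s s' : Finset ℕ} {a ω : ℕ → ℂ} (h : s ⊆ s')
    (h0 : ∀ n ∈ s', n ∉ s → a n = 0) : pairSum s a ω = pairSum s' a ω := by
  funext t
  refine Finset.sum_subset h fun n hn hns => ?_
  rw [h0 n hn hns]
  simp [conjPairExp]

theorem pairSum_sub (s : Finset ℕ) (a a' ω : ℕ → ℂ) (t : ℝ) :
    pairSum s (fun n => a n - a' n) ω t = pairSum s a ω t - pairSum s a' ω t := by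
  simp only [pairSum, conjPairExp, ← Finset.sum_sub_distrib, map_sub]
  exact Finset.sum_congr rfl fun n _ => by ring

theorem oscPart₁_sub (ω ζ C D C' D' : ℕ → ℂ) (s : Finset ℕ) (t : ℝ) :
    oscPart₁ ω ζ (fun n => C n - C' n) (fun n => D n - D' n) s t
      = oscPart₁ ω ζ C D s t - oscPart₁ ω ζ C' D' s t := by
  simp only [oscPart₁, pairSum_sub]
  ring

theorem oscPart₂_sub (ω ζ c d C D C' D' : ℕ → ℂ) (s : Finset ℕ) (t : ℝ) :
    oscPart₂ ω ζ c d (fun n => C n - C' n) (fun n => D n - D' n) s t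
      = oscPart₂ ω ζ c d C D s t - oscPart₂ ω ζ c d C' D' s t := by
  simp only [oscPart₂, mul_sub, pairSum_sub]
  ring

theorem realPart₁_sub (r R R' : ℕ → ℝ) (s : Finset ℕ) (t : ℝ) :
    realPart₁ r (fun n => R n - R' n) s t = realPart₁ r R s t - realPart₁ r R' s t := by
  simp only [realPart₁, ← Finset.sum_sub_distrib, ofReal_sub, sub_mul]

theorem oscPart₁_eq_of_subset {ω ζ C D : ℕ → ℂ} {s s' : Finset ℕ} (h : s ⊆ s')
    (h0 : ∀ n ∈ s', n ∉ s → C n = 0 ∧ D n = 0) : oscPart₁ ω ζ C D s = oscPart₁ ω ζ C D s' := by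
  funext t
  rw [oscPart₁, oscPart₁, pairSum_eq_of_subset h fun n hn hns => (h0 n hn hns).1,
    pairSum_eq_of_subset h fun n hn hns => (h0 n hn hns).2]

theorem oscPart₂_eq_of_subset {ω ζ c d C D : ℕ → ℂ} {s s' : Finset ℕ} (h : s ⊆ s')
    (h0 : ∀ n ∈ s', n ∉ s → C n = 0 ∧ D n = 0) :
    oscPart₂ ω ζ c d C D s = oscPart₂ ω ζ c d C D s' := by
  funext t
  rw [oscPart₂, oscPart₂,
    pairSum_eq_of_subset h (a := fun n => d n * D n) fun n hn hns => by simp [(h0 n hn hns).2],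
    pairSum_eq_of_subset h (a := fun n => c n * C n) fun n hn hns => by simp [(h0 n hn hns).1]]

theorem realPart₁_eq_of_subset {r R : ℕ → ℝ} {s s' : Finset ℕ} (h : s ⊆ s')
    (h0 : ∀ n ∈ s', n ∉ s → R n = 0) : realPart₁ r R s = realPart₁ r R s' := by
  funext t
  refine Finset.sum_subset h fun n hn hns => ?_
  rw [h0 n hn hns]
  simp

theorem realPart₁_filter_add (r R : ℕ → ℝ) (s : Finset ℕ) (p : ℕ → Prop) [DecidablePred p]
    (t : ℝ) : realPart₁ r R s t
      = realPart₁ r R (s.filter p) t + realPart₁ r R (s.filter fun n => ¬ p n) t :=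
  (Finset.sum_filter_add_sum_filter_not s _ _).symm

/-- Closed balls are compact. Limits along one ultrafilter replace successive extraction of
subsequences. -/
theorem Ultrafilter.exists_tendsto_of_norm_le {E : Type*} [NormedAddCommGroup E] [ProperSpace E]
    (U : Ultrafilter ℕ) {f : ℕ → E} {K : ℝ} (h : ∀ j, ‖f j‖ ≤ K) : ∃ x, Tendsto f U (𝓝 x) := by
  obtain ⟨x, -, hx⟩ := (isCompact_closedBall (0 : E) K).ultrafilter_le_nhds (U.map f) (by
    rw [Ultrafilter.coe_map, le_principal_iff, Filter.mem_map]
    exact Filter.univ_mem' fun j => by simpa using h j)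
  exact ⟨x, hx⟩

/-- Sums of products of an `ℓ²` sequence with unit vectors of `ℓ²` that tend to zero
coordinatewise tend to zero. -/
theorem tendsto_sum_abs_zero {a : ℕ → ℝ} (ha : Summable fun n => a n ^ 2) {d : ℕ → ℂ}
    {C D : ℕ → ℕ → ℂ} {R : ℕ → ℕ → ℝ} {N : ℕ} {s : ℕ → Finset ℕ} (hs : ∀ j, ∀ n ∈ s j, N ≤ n)
    (hR : ∀ j n, |R j n| ≤ a n * Real.sqrt (pairEnergy d (C j) (D j) n))
    (hE : ∀ j, ∑ n ∈ s j, pairEnergy d (C j) (D j) n ≤ 1)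
    (h0 : ∀ n, N ≤ n → Tendsto (fun j => pairEnergy d (C j) (D j) n) atTop (𝓝 0)) :
    Tendsto (fun j => ∑ n ∈ s j, |R j n|) atTop (𝓝 0) := by
  have hR0 : ∀ n, N ≤ n → Tendsto (fun j => |R j n|) atTop (𝓝 0) := by
    intro n hn
    refine squeeze_zero (fun j => abs_nonneg _) (fun j => hR j n) ?_
    have := ((Real.continuous_sqrt.tendsto 0).comp (h0 n hn)).const_mul (a n)
    simpa using this
  rw [Metric.tendsto_atTop]
  intro ε hε
  -- Outside `F` Cauchy–Schwarz makes the sum small uniformly in `j`; on `F` there are finitely many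
  -- terms, each tending to zero.
  obtain ⟨F, hF⟩ := summable_iff_vanishing_norm.1 ha ((ε / 2) ^ 2) (by positivity)
  have hfin : Tendsto (fun j => ∑ n ∈ F.filter (fun n => N ≤ n), |R j n|) atTop (𝓝 0) := by
    have := tendsto_finsetSum (F.filter (fun n => N ≤ n))
      (fun n hn => hR0 n (Finset.mem_filter.1 hn).2)
    simpa using this
  obtain ⟨j₀, hj₀⟩ := eventually_atTop.1 (hfin.eventually (gt_mem_nhds (half_pos hε)))
  refine ⟨j₀, fun j hj => ?_⟩
  rw [Real.dist_eq, sub_zero, abs_of_nonneg (Finset.sum_nonneg fun _ _ => abs_nonneg _)]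
  have hsplit := Finset.sum_filter_add_sum_filter_not (s j) (fun n => n ∈ F) (fun n => |R j n|)
  have h1 : ∑ n ∈ (s j).filter (fun n => n ∈ F), |R j n|
      ≤ ∑ n ∈ F.filter (fun n => N ≤ n), |R j n| := by
    refine Finset.sum_le_sum_of_subset_of_nonneg (fun n hn => ?_) fun _ _ _ => abs_nonneg _
    obtain ⟨hn1, hn2⟩ := Finset.mem_filter.1 hn
    exact Finset.mem_filter.2 ⟨hn2, hs j n hn1⟩
  have h2 : ∑ n ∈ (s j).filter (fun n => n ∉ F), |R j n| ≤ ε / 2 := by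
    apply le_of_sq_le_sq _ (by positivity)
    refine (ExponentialSystem.sum_abs_R_sq_le (fun n _ => hR j n)).trans ?_
    have t1 := hF ((s j).filter (fun n => n ∉ F)) (by
      rw [Finset.disjoint_left]
      exact fun n hn => (Finset.mem_filter.1 hn).2)
    rw [Real.norm_eq_abs] at t1
    have t2 : ∑ n ∈ (s j).filter (fun n => n ∉ F), pairEnergy d (C j) (D j) n ≤ 1 :=
      (Finset.sum_le_sum_of_subset_of_nonneg (Finset.filter_subset _ _)
        fun n _ _ => pairEnergy_nonneg _ _ _ _).trans (hE j)
    calc _ ≤ (ε / 2) ^ 2 * 1 := mul_le_mul ((le_abs_self _).trans t1.le) t2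
          (Finset.sum_nonneg fun n _ => pairEnergy_nonneg _ _ _ _) (by positivity)
      _ = _ := mul_one _
  have := hj₀ j hj
  linarith

theorem sqInt_realPart₁_le {L B : ℝ} {r R : ℕ → ℝ} (hL : 0 ≤ L) (hB : ∀ n, |r n| ≤ B)
    (s : Finset ℕ) :
    sqInt L (realPart₁ r R s) ≤ L * (Real.exp (B * L) * ∑ n ∈ s, |R n|) ^ 2 :=
  sqInt_le_of_norm_le hL (by fun_prop)
    (fun _ h0 ht => ExponentialSystem.norm_realPart₁_le hB h0 ht s)

theorem filter_not_le_range {N W : ℕ} (h : N ≤ W) :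
    (Finset.range W).filter (fun n => ¬ N ≤ n) = Finset.range N := by
  ext n
  simp only [Finset.mem_filter, Finset.mem_range]
  omega

/-! ### The compactness argument -/

namespace ExponentialSystem

variable {ω ζ : ℕ → ℂ} {r a : ℕ → ℝ} {c d : ℕ → ℂ} {γ α : ℝ}

theorem coeff_eq_zero_of_energy (h : ExponentialSystem ω ζ r a c d γ α) {C D : ℕ → ℂ} {n : ℕ}
    (h0 : pairEnergy d C D n = 0) : C n = 0 ∧ D n = 0 := by
  have h1 := sq_nonneg ‖C n‖
  have h2 := sq_nonneg ‖d n * D n‖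
  unfold pairEnergy at h0
  have h3 : ‖C n‖ ^ 2 = 0 := by linarith
  have h4 : ‖d n * D n‖ ^ 2 = 0 := by linarith
  simp only [ne_eq, OfNat.ofNat_ne_zero, not_false_eq_true, pow_eq_zero_iff, norm_eq_zero,
    mul_eq_zero] at h3 h4
  exact ⟨h3, h4.resolve_left (h.d_ne n)⟩

/-- The low-frequency coefficients converge along an ultrafilter and the corresponding signals
converge to the signal of the limit. -/
theorem exists_low_limit (h : ExponentialSystem ω ζ r a c d γ α) (η : ℝ) {M T : ℝ} (hT : 0 < T)
    (U : Ultrafilter ℕ) (P : Finset ℕ) {C D : ℕ → ℕ → ℂ} {R : ℕ → ℕ → ℝ} {E : ℕ → ℝ}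
    (hR : ∀ j n, |R j n| ≤ a n * Real.sqrt (pairEnergy d (C j) (D j) n))
    (hE : ∀ j n, pairEnergy d (C j) (D j) n ≤ 1) (hEM : ∀ j, |E j| ≤ M) :
    ∃ (C' D' : ℕ → ℂ) (R' : ℕ → ℝ) (E' : ℝ),
      (∀ n, Tendsto (fun j => C j n) U (𝓝 (C' n))) ∧
      (∀ n, Tendsto (fun j => D j n) U (𝓝 (D' n))) ∧
      Tendsto (fun j => sqInt T (fun t => oscPart₁ ω ζ (fun n => C j n - C' n)
          (fun n => D j n - D' n) P t + realPart₁ r (fun n => R j n - R' n) P t)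
        + sqInt T (fun t => oscPart₂ ω ζ c d (fun n => C j n - C' n)
          (fun n => D j n - D' n) P t + ((E j - E' : ℝ) : ℂ) * exp (-(η : ℂ) * t))) U (𝓝 0) := by
  have hC : ∀ n, ∀ j, ‖C j n‖ ≤ 1 := fun n j => by
    have := hE j n
    unfold pairEnergy at this
    nlinarith [sq_nonneg ‖d n * D j n‖, norm_nonneg (C j n)]
  have hdD : ∀ n, ∀ j, ‖d n * D j n‖ ≤ 1 := fun n j => by
    have := hE j n
    unfold pairEnergy at this
    nlinarith [sq_nonneg ‖C j n‖, norm_nonneg (d n * D j n)]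
  have hD : ∀ n, ∀ j, ‖D j n‖ ≤ ‖(d n)⁻¹‖ := fun n j => by
    rw [← inv_mul_cancel_left₀ (h.d_ne n) (D j n), norm_mul]
    exact mul_le_of_le_one_right (norm_nonneg _) (hdD n j)
  have hRb : ∀ n, ∀ j, ‖R j n‖ ≤ a n := fun n j => by
    refine (hR j n).trans (mul_le_of_le_one_right (h.a_nonneg n) ?_)
    rw [Real.sqrt_le_one]
    exact hE j n
  choose C' hC' using fun n => U.exists_tendsto_of_norm_le (hC n)
  choose D' hD' using fun n => U.exists_tendsto_of_norm_le (hD n)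
  choose R' hR' using fun n => U.exists_tendsto_of_norm_le (hRb n)
  obtain ⟨E', hE'⟩ := U.exists_tendsto_of_norm_le (f := E) hEM
  refine ⟨C', D', R', E', hC', hD', ?_⟩
  obtain ⟨K, hK, hosc⟩ := h.exists_osc_upper hT
  obtain ⟨B, hB⟩ := h.r_bdd
  set F : ℕ → ℝ := fun j =>
    2 * (K * ∑ n ∈ P, pairEnergy d (fun n => C j n - C' n) (fun n => D j n - D' n) n)
      + 2 * (T * (Real.exp (B * T) * ∑ n ∈ P, |R j n - R' n|) ^ 2)
      + 2 * (T * (Real.exp (|η| * T) * |E j - E'|) ^ 2) with hF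
  have hC0 : ∀ n, Tendsto (fun j => C j n - C' n) U (𝓝 0) := fun n => by
    simpa using (hC' n).sub_const (C' n)
  have hD0 : ∀ n, Tendsto (fun j => D j n - D' n) U (𝓝 0) := fun n => by
    simpa using (hD' n).sub_const (D' n)
  have hR0 : ∀ n, Tendsto (fun j => |R j n - R' n|) U (𝓝 0) := fun n => by
    simpa using ((hR' n).sub_const (R' n)).abs
  have hE0 : Tendsto (fun j => |E j - E'|) U (𝓝 0) := by
    simpa using (hE'.sub_const E').abs
  have hen0 : ∀ n, Tendsto (fun j => pairEnergy d (fun n => C j n - C' n)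
      (fun n => D j n - D' n) n) U (𝓝 0) := fun n => by
    have := ((hC0 n).norm.pow 2).add (((hD0 n).const_mul (d n)).norm.pow 2)
    simpa [pairEnergy] using this
  have hF0 : Tendsto F U (𝓝 0) := by
    have t1 := tendsto_finsetSum P fun n _ => hen0 n
    have t2 := tendsto_finsetSum P fun n _ => hR0 n
    have := (((t1.const_mul K).const_mul 2).add
      ((((t2.const_mul (Real.exp (B * T))).pow 2).const_mul T).const_mul 2)).add
      ((((hE0.const_mul (Real.exp (|η| * T))).pow 2).const_mul T).const_mul 2)
    simpa [hF] using this
  refine squeeze_zero (fun j => add_nonneg (sqInt_nonneg hT.le _) (sqInt_nonneg hT.le _))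
    (fun j => ?_) hF0
  have h1 := hosc P (fun n => C j n - C' n) (fun n => D j n - D' n)
  have h2 := sqInt_realPart₁_le (R := fun n => R j n - R' n) hT.le hB P
  have h3 : sqInt T (fun t => ((E j - E' : ℝ) : ℂ) * exp (-(η : ℂ) * t))
      ≤ T * (Real.exp (|η| * T) * |E j - E'|) ^ 2 := by
    refine sqInt_le_of_norm_le hT.le (by fun_prop) fun t h0 ht => ?_
    rw [norm_mul, mul_comm, norm_real, Real.norm_eq_abs, norm_exp]
    gcongr
    rw [← ofReal_neg, ← ofReal_mul, ofReal_re]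
    calc -η * t ≤ |η| * t := by gcongr; exact neg_le_abs η
      _ ≤ |η| * T := by gcongr
  have h4 := sqInt_add_le hT.le
    (f := oscPart₁ ω ζ (fun n => C j n - C' n) (fun n => D j n - D' n) P)
    (g := realPart₁ r (fun n => R j n - R' n) P) (by fun_prop) (by fun_prop)
  have h5 := sqInt_add_le hT.le
    (f := oscPart₂ ω ζ c d (fun n => C j n - C' n) (fun n => D j n - D' n) P)
    (g := fun t => ((E j - E' : ℝ) : ℂ) * exp (-(η : ℂ) * t)) (by fun_prop) (by fun_prop)
  simp only [hF]
  linarith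

/-- Signals cannot tend to zero while the energy stays equal to one. -/
theorem not_tendsto_zero (h : ExponentialSystem ω ζ r a c d γ α)
    (hinj : Function.Injective (exponent₁ ω ζ r)) (η M : ℝ) {T : ℝ} (hT : 0 < T)
    (hγT : 2 * Real.pi < γ * T) {S : ℕ → ℕ} {C D : ℕ → ℕ → ℂ} {R : ℕ → ℕ → ℝ} {E : ℕ → ℝ}
    (hR : ∀ j n, |R j n| ≤ a n * Real.sqrt (pairEnergy d (C j) (D j) n))
    (hS : ∀ j n, S j ≤ n → pairEnergy d (C j) (D j) n = 0)
    (hE : ∀ j, ∑ n ∈ Finset.range (S j), pairEnergy d (C j) (D j) n = 1) (hEM : ∀ j, |E j| ≤ M)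
    (hJ : Tendsto (fun j => sqInt T (fun t => oscPart₁ ω ζ (C j) (D j) (Finset.range (S j)) t
              + realPart₁ r (R j) (Finset.range (S j)) t)
            + sqInt T (fun t => oscPart₂ ω ζ c d (C j) (D j) (Finset.range (S j)) t
              + E j * exp (-(η : ℂ) * t))) atTop (𝓝 0)) : False := by
  obtain ⟨N₁, hN₁⟩ := h.exists_tendsto_coeff η M hT hγT
  obtain ⟨N₂, k, hk, hlow⟩ := h.exists_lower hT hγT
  obtain ⟨K, hK, hosc⟩ := h.exists_osc_upper hT
  obtain ⟨B, hB⟩ := h.r_bdd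
  have hcoef := hN₁ S C D R E hR hS (fun j => (hE j).le) hEM hJ
  set N := max N₁ N₂ with hN
  set P := Finset.range N with hP
  -- Padding with zero coefficients up to `N` makes the low-frequency block the same set `P` for
  -- every `j`.
  set W : ℕ → ℕ := fun j => max (S j) N with hW
  set s : ℕ → Finset ℕ := fun j => (Finset.range (W j)).filter (fun n => N ≤ n) with hs
  have hzero : ∀ j n, S j ≤ n → C j n = 0 ∧ D j n = 0 := fun j n hn =>
    h.coeff_eq_zero_of_energy (hS j n hn)
  have hRzero : ∀ j n, S j ≤ n → R j n = 0 := fun j n hn => by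
    have := hR j n
    rw [hS j n hn, Real.sqrt_zero, mul_zero] at this
    exact abs_eq_zero.1 (le_antisymm this (abs_nonneg _))
  have hsubW : ∀ j, Finset.range (S j) ⊆ Finset.range (W j) := fun j =>
    Finset.range_subset_range.2 (le_max_left _ _)
  have hlow_eq : ∀ j, (Finset.range (W j)).filter (fun n => ¬ N ≤ n) = P := fun j =>
    filter_not_le_range (le_max_right _ _)
  have hen1 : ∀ j n, pairEnergy d (C j) (D j) n ≤ 1 := fun j n => by
    rcases le_or_gt (S j) n with hn | hn
    · rw [hS j n hn]; exact zero_le_one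
    · rw [← hE j]
      exact Finset.single_le_sum (f := pairEnergy d (C j) (D j))
        (fun _ _ => pairEnergy_nonneg _ _ _ _) (Finset.mem_range.2 hn)
  have hEsplit : ∀ j, ∑ n ∈ s j, pairEnergy d (C j) (D j) n
      + ∑ n ∈ P, pairEnergy d (C j) (D j) n = 1 := fun j => by
    have e1 := Finset.sum_filter_add_sum_filter_not (Finset.range (W j)) (fun n => N ≤ n)
      (pairEnergy d (C j) (D j))
    rw [hlow_eq] at e1
    rw [e1, ← hE j]
    symm
    exact Finset.sum_subset (hsubW j) fun n _ hn => hS j n (by simpa using hn)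
  have hEs : ∀ j, ∑ n ∈ s j, pairEnergy d (C j) (D j) n ≤ 1 := fun j => by
    have := Finset.sum_nonneg (s := P) fun n _ => pairEnergy_nonneg d (C j) (D j) n
    linarith [hEsplit j]
  have hu₁ : ∀ j, (fun t => oscPart₁ ω ζ (C j) (D j) (Finset.range (S j)) t
      + realPart₁ r (R j) (Finset.range (S j)) t) = fun t =>
        (oscPart₁ ω ζ (C j) (D j) (s j) t + oscPart₁ ω ζ (C j) (D j) P t)
        + (realPart₁ r (R j) (s j) t + realPart₁ r (R j) P t) := fun j => by
    funext t
    rw [oscPart₁_eq_of_subset (hsubW j) (fun n _ hn => hzero j n (by simpa using hn)),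
      realPart₁_eq_of_subset (hsubW j) (fun n _ hn => hRzero j n (by simpa using hn)),
      oscPart₁_filter_add _ _ _ _ _ (fun n => N ≤ n), hlow_eq,
      realPart₁_filter_add _ _ _ (fun n => N ≤ n), hlow_eq]
  have hu₂ : ∀ j, (fun t : ℝ => oscPart₂ ω ζ c d (C j) (D j) (Finset.range (S j)) t
      + E j * exp (-(η : ℂ) * t)) = fun t : ℝ =>
        (oscPart₂ ω ζ c d (C j) (D j) (s j) t + oscPart₂ ω ζ c d (C j) (D j) P t)
        + E j * exp (-(η : ℂ) * t) := fun j => by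
    funext t
    rw [oscPart₂_eq_of_subset (hsubW j) (fun n _ hn => hzero j n (by simpa using hn)),
      oscPart₂_filter_add _ _ _ _ _ _ _ (fun n => N ≤ n), hlow_eq]
  have hRhigh : Tendsto (fun j => ∑ n ∈ s j, |R j n|) atTop (𝓝 0) :=
    tendsto_sum_abs_zero h.a_sq (N := N) (fun j n hn => (Finset.mem_filter.1 hn).2) hR hEs
      fun n hn => hcoef n (le_of_max_le_left hn)
  set U : Ultrafilter ℕ := hyperfilter ℕ with hU
  have hUle : (U : Filter ℕ) ≤ atTop := Nat.hyperfilter_le_atTop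
  obtain ⟨C', D', R', E', hC', hD', hlim⟩ := h.exists_low_limit η hT U P hR hen1 hEM
  -- the high-frequency part converges to minus the limit of the low-frequency part
  set Q : ℕ → ℝ := fun j =>
    sqInt T (fun t => oscPart₁ ω ζ (C j) (D j) (s j) t
      + (oscPart₁ ω ζ C' D' P t + realPart₁ r R' P t))
    + sqInt T (fun t : ℝ => oscPart₂ ω ζ c d (C j) (D j) (s j) t
      + (oscPart₂ ω ζ c d C' D' P t + E' * exp (-(η : ℂ) * t))) with hQ
  have hQ0 : Tendsto Q U (𝓝 0) := by
    have t1 := hJ.mono_left hUle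
    have t2 : Tendsto (fun j => T * (Real.exp (B * T) * ∑ n ∈ s j, |R j n|) ^ 2) U (𝓝 0) := by
      have := (((hRhigh.mono_left hUle).const_mul (Real.exp (B * T))).pow 2).const_mul T
      simpa using this
    have t3 := ((t1.const_mul 4).add (t2.const_mul 4)).add (hlim.const_mul 2)
    simp only [mul_zero, add_zero] at t3
    refine squeeze_zero (fun j => add_nonneg (sqInt_nonneg hT.le _) (sqInt_nonneg hT.le _))
      (fun j => ?_) t3
    have g1 := sqInt_realPart₁_le (R := R j) hT.le hB (s j)
    rw [hu₁, hu₂]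
    set u₁ : ℝ → ℂ := fun t =>
        (oscPart₁ ω ζ (C j) (D j) (s j) t + oscPart₁ ω ζ (C j) (D j) P t)
        + (realPart₁ r (R j) (s j) t + realPart₁ r (R j) P t) with hu₁def
    set u₂ : ℝ → ℂ := fun t =>
        (oscPart₂ ω ζ c d (C j) (D j) (s j) t + oscPart₂ ω ζ c d (C j) (D j) P t)
        + E j * exp (-(η : ℂ) * t) with hu₂def
    have c1 : Continuous u₁ := by fun_prop
    have c2 : Continuous u₂ := by fun_prop
    have g2 := sqInt_sub_le hT.le c1 (continuous_realPart₁ r (R j) (s j))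
    have g3 := sqInt_sub_le hT.le (f := fun t => u₁ t - realPart₁ r (R j) (s j) t)
      (g := fun t => oscPart₁ ω ζ (fun n => C j n - C' n)
          (fun n => D j n - D' n) P t + realPart₁ r (fun n => R j n - R' n) P t)
      (by fun_prop) (by fun_prop)
    have g4 := sqInt_sub_le hT.le (f := u₂)
      (g := fun t : ℝ => oscPart₂ ω ζ c d (fun n => C j n - C' n)
          (fun n => D j n - D' n) P t + ((E j - E' : ℝ) : ℂ) * exp (-(η : ℂ) * t))
      (by fun_prop) (by fun_prop)
    have e1 : (fun t => u₁ t - realPart₁ r (R j) (s j) t - (oscPart₁ ω ζ (fun n => C j n - C' n)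
          (fun n => D j n - D' n) P t + realPart₁ r (fun n => R j n - R' n) P t))
        = fun t => oscPart₁ ω ζ (C j) (D j) (s j) t
          + (oscPart₁ ω ζ C' D' P t + realPart₁ r R' P t) := by
      funext t
      rw [oscPart₁_sub, realPart₁_sub, hu₁def]
      ring
    have e2 : (fun t : ℝ => u₂ t - (oscPart₂ ω ζ c d (fun n => C j n - C' n)
          (fun n => D j n - D' n) P t + ((E j - E' : ℝ) : ℂ) * exp (-(η : ℂ) * t)))
        = fun t : ℝ => oscPart₂ ω ζ c d (C j) (D j) (s j) t
          + (oscPart₂ ω ζ c d C' D' P t + E' * exp (-(η : ℂ) * t)) := by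
      funext t
      rw [oscPart₂_sub, hu₂def]
      push_cast
      ring
    rw [e1] at g3
    rw [e2] at g4
    have p2 := sqInt_nonneg hT.le u₂
    simp only [hQ]
    linarith
  -- A Cauchy estimate: subtracting the high parts for `j` and `l` cancels the common low-frequency
  -- limit, and the Riesz bound on `s j ∪ s l` turns small signals into small coefficients.
  have hpair : ∀ j l, k * ∑ n ∈ s j, pairEnergy d (fun n => C j n - C l n)
      (fun n => D j n - D l n) n ≤ 2 * Q j + 2 * Q l := fun j l => by
    have hs1 : ∀ n ∈ s j ∪ s l, N ≤ n := fun n hn => by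
      rcases Finset.mem_union.1 hn with hn | hn <;> exact (Finset.mem_filter.1 hn).2
    have hout : ∀ i, ∀ n ∈ s j ∪ s l, n ∉ s i → C i n = 0 ∧ D i n = 0 := fun i n hn hni => by
      refine hzero i n ?_
      by_contra hlt
      exact hni (Finset.mem_filter.2 ⟨hsubW i (by simpa using hlt), hs1 n hn⟩)
    have l1 := hlow (s j ∪ s l) (fun n hn => le_of_max_le_right (hs1 n hn))
      (fun n => C j n - C l n) (fun n => D j n - D l n)
    have l2 : ∑ n ∈ s j, pairEnergy d (fun n => C j n - C l n) (fun n => D j n - D l n) n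
        ≤ ∑ n ∈ s j ∪ s l, pairEnergy d (fun n => C j n - C l n) (fun n => D j n - D l n) n :=
      Finset.sum_le_sum_of_subset_of_nonneg Finset.subset_union_left
        fun n _ _ => pairEnergy_nonneg _ _ _ _
    have l3 := sqInt_sub_le hT.le
      (f := fun t => oscPart₁ ω ζ (C j) (D j) (s j) t
        + (oscPart₁ ω ζ C' D' P t + realPart₁ r R' P t))
      (g := fun t => oscPart₁ ω ζ (C l) (D l) (s l) t
        + (oscPart₁ ω ζ C' D' P t + realPart₁ r R' P t)) (by fun_prop) (by fun_prop)
    have l4 := sqInt_sub_le hT.le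
      (f := fun t : ℝ => oscPart₂ ω ζ c d (C j) (D j) (s j) t
        + (oscPart₂ ω ζ c d C' D' P t + E' * exp (-(η : ℂ) * t)))
      (g := fun t : ℝ => oscPart₂ ω ζ c d (C l) (D l) (s l) t
        + (oscPart₂ ω ζ c d C' D' P t + E' * exp (-(η : ℂ) * t))) (by fun_prop) (by fun_prop)
    have e1 : oscPart₁ ω ζ (fun n => C j n - C l n) (fun n => D j n - D l n) (s j ∪ s l)
        = fun t => oscPart₁ ω ζ (C j) (D j) (s j) t
            + (oscPart₁ ω ζ C' D' P t + realPart₁ r R' P t)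
          - (oscPart₁ ω ζ (C l) (D l) (s l) t
            + (oscPart₁ ω ζ C' D' P t + realPart₁ r R' P t)) := by
      funext t
      rw [oscPart₁_sub, ← oscPart₁_eq_of_subset Finset.subset_union_left (hout j),
        ← oscPart₁_eq_of_subset Finset.subset_union_right (hout l)]
      ring
    have e2 : oscPart₂ ω ζ c d (fun n => C j n - C l n) (fun n => D j n - D l n) (s j ∪ s l)
        = fun t : ℝ => oscPart₂ ω ζ c d (C j) (D j) (s j) t
            + (oscPart₂ ω ζ c d C' D' P t + E' * exp (-(η : ℂ) * t))
          - (oscPart₂ ω ζ c d (C l) (D l) (s l) t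
            + (oscPart₂ ω ζ c d C' D' P t + E' * exp (-(η : ℂ) * t))) := by
      funext t
      rw [oscPart₂_sub, ← oscPart₂_eq_of_subset Finset.subset_union_left (hout j),
        ← oscPart₂_eq_of_subset Finset.subset_union_right (hout l)]
      ring
    rw [e1, e2] at l1
    have := mul_le_mul_of_nonneg_left l2 hk.le
    simp only [hQ]
    linarith
  have hC0 : ∀ n, N ≤ n → Tendsto (fun l => C l n) U (𝓝 0) ∧
      Tendsto (fun l => d n * D l n) U (𝓝 0) := fun n hn => by
    have t0 := hcoef n (le_of_max_le_left hn)
    have t1 : Tendsto (fun l => Real.sqrt (pairEnergy d (C l) (D l) n)) U (𝓝 0) := by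
      have := (Real.continuous_sqrt.tendsto 0).comp (t0.mono_left hUle)
      simpa [Function.comp_def] using this
    constructor
    · refine squeeze_zero_norm (fun l => ?_) t1
      apply Real.le_sqrt_of_sq_le
      unfold pairEnergy
      linarith [sq_nonneg ‖d n * D l n‖]
    · refine squeeze_zero_norm (fun l => ?_) t1
      apply Real.le_sqrt_of_sq_le
      unfold pairEnergy
      linarith [sq_nonneg ‖C l n‖]
  -- Let `l` run along `U` with `j` fixed: the sum is finite and each coefficient with index `l`
  -- tends to zero, so only the energy of the `j`-th high part is left.
  have hhigh : ∀ j, k * ∑ n ∈ s j, pairEnergy d (C j) (D j) n ≤ 2 * Q j := fun j => by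
    have t1 : Tendsto (fun l => k * ∑ n ∈ s j, pairEnergy d (fun n => C j n - C l n)
        (fun n => D j n - D l n) n) U (𝓝 (k * ∑ n ∈ s j, pairEnergy d (C j) (D j) n)) := by
      refine (tendsto_finsetSum _ fun n hn => ?_).const_mul k
      obtain ⟨q1, q2⟩ := hC0 n (Finset.mem_filter.1 hn).2
      have := ((q1.const_sub (C j n)).norm.pow 2).add ((q2.const_sub (d n * D j n)).norm.pow 2)
      simpa [pairEnergy, mul_sub] using this
    have t2 : Tendsto (fun l => 2 * Q j + 2 * Q l) U (𝓝 (2 * Q j + 2 * 0)) :=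
      (hQ0.const_mul 2).const_add _
    rw [mul_zero, add_zero] at t2
    exact le_of_tendsto_of_tendsto' t1 t2 (hpair j)
  have hhigh0 : Tendsto (fun j => ∑ n ∈ s j, pairEnergy d (C j) (D j) n) U (𝓝 0) := by
    have := hQ0.const_mul (2 / k)
    rw [mul_zero] at this
    refine squeeze_zero (fun j => Finset.sum_nonneg fun n _ => pairEnergy_nonneg _ _ _ _)
      (fun j => ?_) this
    rw [div_mul_eq_mul_div, le_div_iff₀' hk]
    exact hhigh j
  -- hence the limit of the low-frequency part vanishes
  have hlow0 : sqInt T (fun t => oscPart₁ ω ζ C' D' P t + realPart₁ r R' P t) = 0 := by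
    have t1 := (hQ0.const_mul 2).add ((hhigh0.const_mul K).const_mul 2)
    simp only [mul_zero, add_zero] at t1
    refine le_antisymm (ge_of_tendsto' t1 fun j => ?_) (sqInt_nonneg hT.le _)
    have g1 := sqInt_sub_le hT.le
      (f := fun t => oscPart₁ ω ζ (C j) (D j) (s j) t
        + (oscPart₁ ω ζ C' D' P t + realPart₁ r R' P t))
      (g := oscPart₁ ω ζ (C j) (D j) (s j)) (by fun_prop) (by fun_prop)
    simp only [add_sub_cancel_left] at g1
    have g2 := hosc (s j) (C j) (D j)
    have g3 := sqInt_nonneg hT.le (oscPart₂ ω ζ c d (C j) (D j) (s j))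
    have g4 := sqInt_nonneg hT.le (fun t : ℝ => oscPart₂ ω ζ c d (C j) (D j) (s j) t
      + (oscPart₂ ω ζ c d C' D' P t + E' * exp (-(η : ℂ) * t)))
    simp only [hQ]
    linarith
  have hvan := coeff_eq_zero_of_vanishing hinj hT
    (eq_zero_of_sqInt_eq_zero (by fun_prop) hlow0)
  have hlowE : Tendsto (fun j => ∑ n ∈ P, pairEnergy d (C j) (D j) n) U (𝓝 0) := by
    have : Tendsto (fun j => ∑ n ∈ P, pairEnergy d (C j) (D j) n) U (𝓝 (∑ n ∈ P, (0 : ℝ))) := by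
      refine tendsto_finsetSum _ fun n hn => ?_
      have := ((hC' n).norm.pow 2).add (((hD' n).const_mul (d n)).norm.pow 2)
      rw [(hvan n hn).1, (hvan n hn).2] at this
      simpa [pairEnergy] using this
    simpa using this
  have hone := hhigh0.add hlowE
  simp only [hEsplit, add_zero] at hone
  exact one_ne_zero (tendsto_nhds_unique hone tendsto_const_nhds).symm

end ExponentialSystem

/-! ### Homogeneity and the two inequalities for finite sums -/

theorem sqInt_const_mul (L : ℝ) (x : ℝ) (f : ℝ → ℂ) :
    sqInt L (fun t => (x : ℂ) * f t) = x ^ 2 * sqInt L f := by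
  unfold sqInt
  rw [← intervalIntegral.integral_const_mul]
  congr 1
  funext t
  rw [norm_mul, mul_pow, norm_real, Real.norm_eq_abs, sq_abs]

theorem pairSum_smul {s : Finset ℕ} {a a' ω : ℕ → ℂ} (x : ℝ)
    (h : ∀ n ∈ s, a' n = x * a n) (t : ℝ) : pairSum s a' ω t = x * pairSum s a ω t := by
  simp only [pairSum, Finset.mul_sum]
  refine Finset.sum_congr rfl fun n hn => ?_
  rw [h n hn]
  simp only [conjPairExp, map_mul, conj_ofReal]
  ring

theorem oscPart₁_smul {ω ζ C D C' D' : ℕ → ℂ} {s : Finset ℕ} (x : ℝ)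
    (hC : ∀ n ∈ s, C' n = x * C n) (hD : ∀ n ∈ s, D' n = x * D n) (t : ℝ) :
    oscPart₁ ω ζ C' D' s t = x * oscPart₁ ω ζ C D s t := by
  rw [oscPart₁, oscPart₁, pairSum_smul x hC, pairSum_smul x hD, mul_add]

theorem oscPart₂_smul {ω ζ c d C D C' D' : ℕ → ℂ} {s : Finset ℕ} (x : ℝ)
    (hC : ∀ n ∈ s, C' n = x * C n) (hD : ∀ n ∈ s, D' n = x * D n) (t : ℝ) :
    oscPart₂ ω ζ c d C' D' s t = x * oscPart₂ ω ζ c d C D s t := by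
  rw [oscPart₂, oscPart₂,
    pairSum_smul (a := fun n => d n * D n) (a' := fun n => d n * D' n) x
      fun n hn => by rw [hD n hn]; ring,
    pairSum_smul (a := fun n => c n * C n) (a' := fun n => c n * C' n) x
      fun n hn => by rw [hC n hn]; ring, mul_add]

theorem realPart₁_smul {r R R' : ℕ → ℝ} {s : Finset ℕ} (x : ℝ)
    (hR : ∀ n ∈ s, R' n = x * R n) (t : ℝ) :
    realPart₁ r R' s t = x * realPart₁ r R s t := by
  simp only [realPart₁, Finset.mul_sum]
  refine Finset.sum_congr rfl fun n hn => ?_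
  rw [hR n hn]
  push_cast
  ring

namespace ExponentialSystem

variable {ω ζ : ℕ → ℂ} {r a : ℕ → ℝ} {c d : ℕ → ℂ} {γ α : ℝ}

/-- The inverse inequality for finite sums. -/
theorem exists_inverse (h : ExponentialSystem ω ζ r a c d γ α)
    (hinj : Function.Injective (exponent₁ ω ζ r)) (η M : ℝ) {T : ℝ} (hT : 0 < T)
    (hγT : 2 * Real.pi < γ * T) :
    ∃ κ > 0, ∀ (S : ℕ) (C D : ℕ → ℂ) (R : ℕ → ℝ) (E : ℝ),
      (∀ n, |R n| ≤ a n * Real.sqrt (pairEnergy d C D n)) →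
      E ^ 2 ≤ M * ∑ n ∈ Finset.range S, pairEnergy d C D n →
      κ * ∑ n ∈ Finset.range S, pairEnergy d C D n ≤
        sqInt T (fun t => oscPart₁ ω ζ C D (Finset.range S) t
          + realPart₁ r R (Finset.range S) t)
        + sqInt T (fun t => oscPart₂ ω ζ c d C D (Finset.range S) t
          + E * exp (-(η : ℂ) * t)) := by
  by_contra! hcon
  choose S C D R E hR hE hlt using fun j : ℕ => hcon (1 / ((j : ℝ) + 1)) (by positivity)
  set J : ℕ → ℝ := fun j => sqInt T (fun t => oscPart₁ ω ζ (C j) (D j) (Finset.range (S j)) t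
          + realPart₁ r (R j) (Finset.range (S j)) t)
        + sqInt T (fun t => oscPart₂ ω ζ c d (C j) (D j) (Finset.range (S j)) t
          + E j * exp (-(η : ℂ) * t)) with hJ
  have hJ0 : ∀ j, 0 ≤ J j := fun j => add_nonneg (sqInt_nonneg hT.le _) (sqInt_nonneg hT.le _)
  set e : ℕ → ℝ := fun j => ∑ n ∈ Finset.range (S j), pairEnergy d (C j) (D j) n with he
  have hlt' : ∀ j, J j < 1 / ((j : ℝ) + 1) * e j := hlt
  have he0 : ∀ j, 0 < e j := fun j =>
    pos_of_mul_pos_right ((hJ0 j).trans_lt (hlt' j)) (by positivity)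
  set x : ℕ → ℝ := fun j => (Real.sqrt (e j))⁻¹ with hx
  have hx0 : ∀ j, 0 < x j := fun j => inv_pos.2 (Real.sqrt_pos.2 (he0 j))
  have hx2 : ∀ j, x j ^ 2 * e j = 1 := fun j => by
    simp only [hx]
    rw [inv_pow, Real.sq_sqrt (he0 j).le, inv_mul_cancel₀ (he0 j).ne']
  -- Normalisation to energy one, with the coefficients beyond the partial sum, which do not affect
  -- the signals, set to zero.
  set C' : ℕ → ℕ → ℂ := fun j n => if n < S j then x j * C j n else 0 with hC'
  set D' : ℕ → ℕ → ℂ := fun j n => if n < S j then x j * D j n else 0 with hD'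
  set R' : ℕ → ℕ → ℝ := fun j n => if n < S j then x j * R j n else 0 with hR'
  have hCs : ∀ j, ∀ n ∈ Finset.range (S j), C' j n = x j * C j n := fun j n hn =>
    if_pos (Finset.mem_range.1 hn)
  have hDs : ∀ j, ∀ n ∈ Finset.range (S j), D' j n = x j * D j n := fun j n hn =>
    if_pos (Finset.mem_range.1 hn)
  have hRs : ∀ j, ∀ n ∈ Finset.range (S j), R' j n = x j * R j n := fun j n hn =>
    if_pos (Finset.mem_range.1 hn)
  have hen : ∀ j, ∀ n ∈ Finset.range (S j),
      pairEnergy d (C' j) (D' j) n = x j ^ 2 * pairEnergy d (C j) (D j) n := fun j n hn => by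
    rw [pairEnergy, pairEnergy, hCs j n hn, hDs j n hn, mul_left_comm, norm_mul, norm_mul,
      norm_real, Real.norm_eq_abs, mul_pow, mul_pow, sq_abs]
    ring
  have hen0 : ∀ j n, S j ≤ n → pairEnergy d (C' j) (D' j) n = 0 := fun j n hn => by
    simp [pairEnergy, hC', hD', not_lt.2 hn]
  refine h.not_tendsto_zero hinj η (Real.sqrt M) hT hγT (S := S) (C := C') (D := D') (R := R')
    (E := fun j => x j * E j) (fun j n => ?_) hen0 (fun j => ?_) (fun j => ?_) ?_
  · rcases lt_or_ge n (S j) with hn | hn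
    · have hn' := Finset.mem_range.2 hn
      rw [hRs j n hn', hen j n hn', abs_mul, abs_of_pos (hx0 j),
        Real.sqrt_mul (by positivity), Real.sqrt_sq (hx0 j).le, mul_left_comm]
      exact mul_le_mul_of_nonneg_left (hR j n) (hx0 j).le
    · rw [hen0 j n hn]
      simp [hR', not_lt.2 hn]
  · rw [Finset.sum_congr rfl (hen j), ← Finset.mul_sum]
    exact hx2 j
  · apply Real.abs_le_sqrt
    rw [mul_pow]
    calc _ ≤ x j ^ 2 * (M * e j) := by gcongr; exact hE j
      _ = M * (x j ^ 2 * e j) := by ring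
      _ = M := by rw [hx2, mul_one]
  · have hlim := tendsto_one_div_add_atTop_nhds_zero_nat (𝕜 := ℝ)
    refine squeeze_zero (fun j => add_nonneg (sqInt_nonneg hT.le _) (sqInt_nonneg hT.le _))
      (fun j => ?_) hlim
    have e1 : (fun t => oscPart₁ ω ζ (C' j) (D' j) (Finset.range (S j)) t
          + realPart₁ r (R' j) (Finset.range (S j)) t)
        = fun t => (x j : ℂ) * (oscPart₁ ω ζ (C j) (D j) (Finset.range (S j)) t
          + realPart₁ r (R j) (Finset.range (S j)) t) := by
      funext t
      rw [oscPart₁_smul (x j) (hCs j) (hDs j), realPart₁_smul (x j) (hRs j), mul_add]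
    have e2 : (fun t : ℝ => oscPart₂ ω ζ c d (C' j) (D' j) (Finset.range (S j)) t
          + ((x j * E j : ℝ) : ℂ) * exp (-(η : ℂ) * t))
        = fun t : ℝ => (x j : ℂ) * (oscPart₂ ω ζ c d (C j) (D j) (Finset.range (S j)) t
          + E j * exp (-(η : ℂ) * t)) := by
      funext t
      rw [oscPart₂_smul (x j) (hCs j) (hDs j)]
      push_cast
      ring
    rw [e1, e2, sqInt_const_mul, sqInt_const_mul, ← mul_add]
    calc _ ≤ x j ^ 2 * (1 / ((j : ℝ) + 1) * e j) := by gcongr; exact (hlt' j).le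
      _ = 1 / ((j : ℝ) + 1) * (x j ^ 2 * e j) := by ring
      _ = _ := by rw [hx2, mul_one]

/-- The direct inequality for finite sums, including the real exponential in `u₂`. -/
theorem exists_direct (h : ExponentialSystem ω ζ r a c d γ α) (η : ℝ) {M : ℝ} (hM : 0 < M)
    {T : ℝ} (hT : 0 < T) :
    ∃ K > 0, ∀ (S : ℕ) (C D : ℕ → ℂ) (R : ℕ → ℝ) (E : ℝ),
      (∀ n, |R n| ≤ a n * Real.sqrt (pairEnergy d C D n)) →
      E ^ 2 ≤ M * ∑ n ∈ Finset.range S, pairEnergy d C D n →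
        sqInt T (fun t => oscPart₁ ω ζ C D (Finset.range S) t
          + realPart₁ r R (Finset.range S) t)
        + sqInt T (fun t => oscPart₂ ω ζ c d C D (Finset.range S) t
          + E * exp (-(η : ℂ) * t))
        ≤ K * ∑ n ∈ Finset.range S, pairEnergy d C D n := by
  obtain ⟨K, hK, hup⟩ := h.exists_upper hT
  refine ⟨2 * K + 2 * (T * Real.exp (|η| * T) ^ 2 * M), by positivity,
    fun S C D R E hR hE => ?_⟩
  have h1 := hup (Finset.range S) C D R fun n _ => hR n
  have h3 : sqInt T (fun t => (E : ℂ) * exp (-(η : ℂ) * t))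
      ≤ T * (Real.exp (|η| * T) * |E|) ^ 2 := by
    refine sqInt_le_of_norm_le hT.le (by fun_prop) fun t h0 ht => ?_
    rw [norm_mul, mul_comm, norm_real, Real.norm_eq_abs, norm_exp]
    gcongr
    rw [← ofReal_neg, ← ofReal_mul, ofReal_re]
    calc -η * t ≤ |η| * t := by gcongr; exact neg_le_abs η
      _ ≤ |η| * T := by gcongr
  have h4 : T * (Real.exp (|η| * T) * |E|) ^ 2 ≤ T * Real.exp (|η| * T) ^ 2 *
      (M * ∑ n ∈ Finset.range S, pairEnergy d C D n) := by
    rw [mul_pow, sq_abs, ← mul_assoc]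
    gcongr
  have h5 := sqInt_add_le hT.le (f := oscPart₂ ω ζ c d C D (Finset.range S))
    (g := fun t => (E : ℂ) * exp (-(η : ℂ) * t)) (by fun_prop) (by fun_prop)
  have h6 := sqInt_nonneg hT.le (fun t => oscPart₁ ω ζ C D (Finset.range S) t
          + realPart₁ r R (Finset.range S) t)
  linarith

end ExponentialSystem

/-! ### Passage to infinite series in `L²(0,T)` -/

theorem lintegral_enorm_sq_eq {T : ℝ} (hT : 0 ≤ T) {f : ℝ → ℂ} (hf : Continuous f) :
    ∫⁻ t in Set.Ioo 0 T, ‖f t‖ₑ ^ 2 = ENNReal.ofReal (sqInt T f) := by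
  rw [sqInt, intervalIntegral.integral_of_le hT, integral_Ioc_eq_integral_Ioo,
    ofReal_integral_eq_lintegral_ofReal]
  · refine lintegral_congr fun t => ?_
    rw [← ofReal_norm, ENNReal.ofReal_pow (norm_nonneg _)]
  · exact ((by fun_prop : Continuous fun t => ‖f t‖ ^ 2).integrableOn_Icc (a := 0) (b := T)).mono_set
      Set.Ioo_subset_Icc_self
  · exact Eventually.of_forall fun t => by simp only [Pi.zero_apply]; positivity

theorem eLpNorm_two_sq {μ : Measure ℝ} (f : ℝ → ℂ) :
    eLpNorm f 2 μ ^ 2 = ∫⁻ t, ‖f t‖ₑ ^ 2 ∂μ := by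
  have := eLpNorm_nnreal_pow_eq_lintegral (μ := μ) (f := f) (p := 2) two_ne_zero
  simpa using this

theorem memLp_two_of_continuous (T : ℝ) {f : ℝ → ℂ} (hf : Continuous f) :
    MemLp f 2 (volume.restrict (Set.Ioo 0 T)) := by
  obtain ⟨K, hK⟩ := (isCompact_Icc (a := 0) (b := T)).exists_bound_of_continuousOn hf.continuousOn
  refine MemLp.of_bound hf.aestronglyMeasurable K ?_
  filter_upwards [ae_restrict_mem measurableSet_Ioo] with t ht using hK t ⟨ht.1.le, ht.2.le⟩

/-- The norm is continuous: the triangle inequality squeezes it between `‖u‖ ± ‖F N - u‖`. -/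
theorem tendsto_lintegral_enorm_sq {μ : Measure ℝ} {F : ℕ → ℝ → ℂ} {u : ℝ → ℂ}
    (hF : ∀ N, AEStronglyMeasurable (F N) μ) (hu : MemLp u 2 μ)
    (h : Tendsto (fun N => eLpNorm (fun t => F N t - u t) 2 μ) atTop (𝓝 0)) :
    Tendsto (fun N => ∫⁻ t, ‖F N t‖ₑ ^ 2 ∂μ) atTop (𝓝 (∫⁻ t, ‖u t‖ₑ ^ 2 ∂μ)) := by
  have hlim : Tendsto (fun N => eLpNorm (F N) 2 μ) atTop (𝓝 (eLpNorm u 2 μ)) := by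
    have hlo : Tendsto (fun N => eLpNorm u 2 μ - eLpNorm (fun t => F N t - u t) 2 μ) atTop
        (𝓝 (eLpNorm u 2 μ)) := by
      have := ENNReal.Tendsto.sub (tendsto_const_nhds (x := eLpNorm u 2 μ)) h
        (Or.inl hu.eLpNorm_ne_top)
      simpa using this
    have hhi : Tendsto (fun N => eLpNorm u 2 μ + eLpNorm (fun t => F N t - u t) 2 μ) atTop
        (𝓝 (eLpNorm u 2 μ)) := by
      simpa using h.const_add (eLpNorm u 2 μ)
    refine tendsto_of_tendsto_of_tendsto_of_le_of_le hlo hhi (fun N => ?_) (fun N => ?_)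
    · have e : u = F N - fun t => F N t - u t := by
        funext t; simp
      rw [tsub_le_iff_right]
      conv_lhs => rw [e]
      exact eLpNorm_sub_le (hF N) ((hF N).sub hu.1) one_le_two
    · have e : F N = u + fun t => F N t - u t := by
        funext t; simp
      conv_lhs => rw [e]
      exact eLpNorm_add_le hu.1 ((hF N).sub hu.1) one_le_two
  simp_rw [← eLpNorm_two_sq]
  exact ((ENNReal.continuous_pow 2).tendsto _).comp hlim

/-- Convergence in `L²(0, T)` of a series of continuous functions with a Bessel bound. -/
theorem exists_isL2Sum {T K : ℝ} (hT : 0 ≤ T) (hK : 0 < K) {f : ℕ → ℝ → ℂ}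
    (hf : ∀ n, Continuous (f n)) {e : ℕ → ℝ} (he : Summable e)
    (hb : ∀ s : Finset ℕ, sqInt T (fun t => ∑ n ∈ s, f n t) ≤ K * ∑ n ∈ s, e n) :
    ∃ u, IsL2Sum T f u := by
  set μ := volume.restrict (Set.Ioo 0 T) with hμ
  have hmem : ∀ N : ℕ, MemLp (fun t => ∑ n ∈ Finset.range N, f n t) 2 μ := fun N =>
    memLp_two_of_continuous T (by fun_prop)
  set V : ℕ → Lp ℂ 2 μ := fun N => (hmem N).toLp with hV
  have hdist : ∀ N N', N ≤ N' → dist (V N') (V N) ^ 2 ≤ K * ∑ n ∈ Finset.Ico N N', e n := by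
    intro N N' hNN
    have hc : Continuous (fun t => ∑ n ∈ Finset.Ico N N', f n t) := by fun_prop
    have e1 : ((fun t => ∑ n ∈ Finset.range N', f n t) - fun t => ∑ n ∈ Finset.range N, f n t)
        = fun t => ∑ n ∈ Finset.Ico N N', f n t := by
      funext t
      simp only [Pi.sub_apply]
      rw [Finset.sum_Ico_eq_sub _ hNN]
    rw [dist_eq_norm, hV, ← MemLp.toLp_sub, Lp.norm_toLp, e1, ← ENNReal.toReal_pow,
      eLpNorm_two_sq, lintegral_enorm_sq_eq hT hc, ENNReal.toReal_ofReal (sqInt_nonneg hT _)]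
    exact hb _
  have hcauchy : CauchySeq V := by
    rw [Metric.cauchySeq_iff']
    intro ε hε
    obtain ⟨F, hF⟩ := summable_iff_vanishing_norm.1 he (ε ^ 2 / K) (by positivity)
    refine ⟨F.sup id + 1, fun N hN => ?_⟩
    have h1 := hF (Finset.Ico (F.sup id + 1) N) (by
      rw [Finset.disjoint_left]
      intro n hn hnF
      have : n ≤ F.sup id := Finset.le_sup (f := id) hnF
      have := (Finset.mem_Ico.1 hn).1
      omega)
    rw [lt_div_iff₀' hK] at h1
    have h2 := hdist _ N hN
    refine lt_of_pow_lt_pow_left₀ 2 hε.le (h2.trans_lt (lt_of_le_of_lt ?_ h1))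
    gcongr
    exact Real.le_norm_self _
  obtain ⟨v, hv⟩ := cauchySeq_tendsto_of_complete hcauchy
  refine ⟨v, Lp.memLp v, ?_⟩
  have := (Lp.tendsto_Lp_iff_tendsto_eLpNorm'' (fun N t => ∑ n ∈ Finset.range N, f n t) hmem v
    (Lp.memLp v)).1 (by rw [Lp.toLp_coeFn]; exact hv)
  exact this

theorem ofReal_pairEnergy (d C D : ℕ → ℂ) (n : ℕ) :
    ENNReal.ofReal (pairEnergy d C D n) = ‖C n‖ₑ ^ 2 + ‖d n * D n‖ₑ ^ 2 := by
  rw [pairEnergy, ENNReal.ofReal_add (by positivity) (by positivity),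
    ENNReal.ofReal_pow (norm_nonneg _), ENNReal.ofReal_pow (norm_nonneg _),
    ofReal_norm, ofReal_norm]

theorem tendsto_sum_pairEnergy (d C D : ℕ → ℂ) :
    Tendsto (fun N => ENNReal.ofReal (∑ n ∈ Finset.range N, pairEnergy d C D n)) atTop
      (𝓝 (coeffEnergy d C D)) := by
  have := ENNReal.tendsto_nat_tsum (fun n => ‖C n‖ₑ ^ 2 + ‖d n * D n‖ₑ ^ 2)
  refine this.congr fun N => ?_
  rw [ENNReal.ofReal_sum_of_nonneg fun n _ => pairEnergy_nonneg _ _ _ _]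
  exact Finset.sum_congr rfl fun n _ => (ofReal_pairEnergy d C D n).symm

theorem summable_pairEnergy {d C D : ℕ → ℂ} (h : coeffEnergy d C D < ⊤) :
    Summable (pairEnergy d C D) := by
  have h1 : ∑' n, ENNReal.ofReal (pairEnergy d C D n) ≠ ⊤ := by
    simp_rw [ofReal_pairEnergy]
    exact h.ne
  have := ENNReal.summable_toReal h1
  simpa [ENNReal.toReal_ofReal (pairEnergy_nonneg _ _ _ _)] using this

/-- A bound of `ℰ` by the total energy passes, up to a factor, to large partial sums. -/
theorem eventually_sq_le_partial_energy {d C D : ℕ → ℂ} {E M : ℝ} (hM : 0 < M)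
    (h : ‖E‖ₑ ^ 2 ≤ ENNReal.ofReal M * coeffEnergy d C D) :
    ∀ᶠ N in atTop, E ^ 2 ≤ 2 * M * ∑ n ∈ Finset.range N, pairEnergy d C D n := by
  have hE : ‖E‖ₑ ^ 2 = ENNReal.ofReal (E ^ 2) := by
    rw [← ofReal_norm, ← ENNReal.ofReal_pow (norm_nonneg _), Real.norm_eq_abs, sq_abs]
  have hsum : ∀ N, 0 ≤ ∑ n ∈ Finset.range N, pairEnergy d C D n := fun N =>
    Finset.sum_nonneg fun n _ => pairEnergy_nonneg _ _ _ _
  by_cases h0 : coeffEnergy d C D = 0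
  · rw [h0, mul_zero, hE, nonpos_iff_eq_zero, ENNReal.ofReal_eq_zero] at h
    filter_upwards with N
    exact h.trans (mul_nonneg (by positivity) (hsum N))
  -- Doubling `M` makes the inequality strict, so it already holds for large partial sums. Infinite
  -- energy is covered too, since the right side is then infinite.
  · have hlt : ENNReal.ofReal (E ^ 2) < ENNReal.ofReal (2 * M) * coeffEnergy d C D := by
      by_cases htop : coeffEnergy d C D = ⊤
      · rw [htop, ENNReal.mul_top (by simpa using hM)]
        exact ENNReal.ofReal_lt_top
      · rw [← hE]
        refine h.trans_lt ?_
        rw [ENNReal.mul_lt_mul_iff_left h0 htop]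
        exact (ENNReal.ofReal_lt_ofReal_iff (by positivity)).2 (by linarith)
    have hlim := ENNReal.Tendsto.const_mul (a := ENNReal.ofReal (2 * M))
      (tendsto_sum_pairEnergy d C D) (Or.inr ENNReal.ofReal_ne_top)
    filter_upwards [hlim.eventually (lt_mem_nhds hlt)] with N hN
    rw [← ENNReal.ofReal_mul (by positivity)] at hN
    exact (ENNReal.ofReal_le_ofReal_iff (mul_nonneg (by positivity) (hsum N))).1 hN.le

namespace ExponentialSystem

variable {ω ζ : ℕ → ℂ} {r a : ℕ → ℝ} {c d : ℕ → ℂ} {γ α : ℝ}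

theorem exists_isSeriesPair (h : ExponentialSystem ω ζ r a c d γ α) (η : ℝ) {T : ℝ} (hT : 0 < T)
    {C D : ℕ → ℂ} {R : ℕ → ℝ} (E : ℝ)
    (hR : ∀ n, |R n| ≤ a n * Real.sqrt (pairEnergy d C D n)) (hE : coeffEnergy d C D < ⊤) :
    ∃ u₁ u₂ : ℝ → ℂ, IsSeriesPair T η ω ζ r c d C D R E u₁ u₂ := by
  obtain ⟨K, hK, hup⟩ := h.exists_upper hT
  obtain ⟨u₁, hu₁⟩ := exists_isL2Sum hT.le hK (f := firstTerm ω ζ r C D R)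
    (fun n => by unfold firstTerm; fun_prop) (summable_pairEnergy hE) (fun s => by
      simp_rw [sum_firstTerm]
      have := hup s C D R fun n _ => hR n
      have h0 := sqInt_nonneg hT.le (oscPart₂ ω ζ c d C D s)
      linarith)
  obtain ⟨v, hv⟩ := exists_isL2Sum hT.le hK (f := secondTerm ω ζ c d C D)
    (fun n => by unfold secondTerm; fun_prop) (summable_pairEnergy hE) (fun s => by
      simp_rw [sum_secondTerm]
      have := hup s C D R fun n _ => hR n
      have h0 := sqInt_nonneg hT.le (fun t => oscPart₁ ω ζ C D s t + realPart₁ r R s t)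
      have e : sqInt T (fun t => oscPart₂ ω ζ c d C D s t) = sqInt T (oscPart₂ ω ζ c d C D s) := rfl
      linarith)
  refine ⟨u₁, fun t => v t + (E : ℂ) * exp (-(η : ℂ) * t), hu₁, ?_⟩
  simpa using hv

theorem tendsto_energy (η : ℝ) {T : ℝ} (hT : 0 < T) {C D : ℕ → ℂ} {R : ℕ → ℝ} {E : ℝ}
    {u₁ u₂ : ℝ → ℂ} (hu : IsSeriesPair T η ω ζ r c d C D R E u₁ u₂) :
    Tendsto (fun N => ENNReal.ofReal
        (sqInt T (fun t => oscPart₁ ω ζ C D (Finset.range N) t + realPart₁ r R (Finset.range N) t)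
        + sqInt T (fun t => oscPart₂ ω ζ c d C D (Finset.range N) t
          + E * exp (-(η : ℂ) * t)))) atTop
      (𝓝 (∫⁻ t in Set.Ioo 0 T, (‖u₁ t‖ₑ ^ 2 + ‖u₂ t‖ₑ ^ 2))) := by
  obtain ⟨⟨hm₁, ht₁⟩, hm₂, ht₂⟩ := hu
  have hexp : MemLp (fun t : ℝ => (E : ℂ) * exp (-(η : ℂ) * t)) 2
      (volume.restrict (Set.Ioo 0 T)) := memLp_two_of_continuous T (by fun_prop)
  have hm₂' : MemLp u₂ 2 (volume.restrict (Set.Ioo 0 T)) := by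
    have := hm₂.add hexp
    refine this.ae_eq (Eventually.of_forall fun t => ?_)
    simp
  have l₁ := tendsto_lintegral_enorm_sq
    (F := fun N t => oscPart₁ ω ζ C D (Finset.range N) t + realPart₁ r R (Finset.range N) t)
    (fun N => Continuous.aestronglyMeasurable (by fun_prop)) hm₁
    (by simpa only [sum_firstTerm] using ht₁)
  have l₂ := tendsto_lintegral_enorm_sq
    (F := fun N (t : ℝ) => oscPart₂ ω ζ c d C D (Finset.range N) t + E * exp (-(η : ℂ) * t))
    (fun N => Continuous.aestronglyMeasurable (by fun_prop)) hm₂' (by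
      refine ht₂.congr fun N => ?_
      congr 1
      funext t
      rw [sum_secondTerm]
      ring)
  rw [lintegral_add_left' (hm₁.1.enorm.pow_const 2)]
  refine (l₁.add l₂).congr fun N => ?_
  rw [lintegral_enorm_sq_eq hT.le (by fun_prop), lintegral_enorm_sq_eq hT.le (by fun_prop),
    ENNReal.ofReal_add (sqInt_nonneg hT.le _) (sqInt_nonneg hT.le _)]

end ExponentialSystem

/-! ### Checking the hypotheses and conclusion -/

theorem summable_sq_ite_div_rpow (μ : ℝ) {ν : ℝ} (hν : 1 / 2 < ν) (n' : ℕ) :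
    Summable fun n : ℕ => (if n' ≤ n + 1 then μ / ((n : ℝ) + 1) ^ ν else μ) ^ 2 := by
  rw [← summable_nat_add_iff n']
  have h := ((summable_nat_add_iff (n' + 1)).2
    (Real.summable_one_div_nat_rpow.2 (by linarith : 1 < ν * 2))).mul_left (μ ^ 2)
  refine h.congr fun n => ?_
  rw [if_pos (by omega), div_pow, Real.rpow_mul (by positivity), Real.rpow_two]
  push_cast
  rw [add_assoc]
  ring

theorem tendsto_zero_of_norm_le_div {f g : ℕ → ℂ} {M : ℝ} (h : ∀ n, ‖f n‖ ≤ M / ‖g n‖)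
    (hg : Tendsto (fun n => ‖g n‖) atTop atTop) : Tendsto f atTop (𝓝 0) :=
  squeeze_zero_norm h (hg.const_div_atTop M)

/-- Since `√(γ² - 16α²) ≤ γ`, the assumed lower bound on `T` is at least `2π/γ`. -/
theorem two_pi_lt_mul_of_lt {γ α T : ℝ} (hγ : 0 < γ) (hα : 0 < α) (hγα : 4 * α < γ)
    (hT : 2 * Real.pi / Real.sqrt (γ ^ 2 - 16 * α ^ 2) < T) : 0 < T ∧ 2 * Real.pi < γ * T := by
  have hpos : 0 < γ ^ 2 - 16 * α ^ 2 := by nlinarith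
  have hs := Real.sqrt_pos.2 hpos
  have hT0 : 0 < T := lt_trans (by positivity) hT
  rw [div_lt_iff₀ hs] at hT
  have : Real.sqrt (γ ^ 2 - 16 * α ^ 2) ≤ γ := by
    rw [Real.sqrt_le_left hγ.le]
    nlinarith [sq_nonneg α]
  refine ⟨hT0, hT.trans_le ?_⟩
  rw [mul_comm]
  gcongr

theorem mainTheorem2
    (ω ζ : ℕ → ℂ) (r : ℕ → ℝ) (c d : ℕ → ℂ) (η : ℝ)
    -- pairwise distinct numbers
    (hω : Function.Injective ω) (hζ : Function.Injective ζ) (hr : Function.Injective r)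
    (hωζ : ∀ n m, ω n ≠ ζ m) (hωζ' : ∀ n m, ω n ≠ conj (ζ m))
    (hrω : ∀ n m, (r n : ℂ) ≠ I * ω m) (hrζ : ∀ n m, (r n : ℂ) ≠ I * ζ m)
    (hrη : ∀ n, r n ≠ -η) (hζ0 : ∀ n, ζ n ≠ 0)
    -- no exponent `iω_n`, `iζ_n` coincides with a conjugate exponent `-i conj(ω_m)`, `-i conj(ζ_m)`
    (hωω : ∀ n m, ω n ≠ -conj (ω m)) (hζζ : ∀ n m, ζ n ≠ -conj (ζ m))
    (hωζ'' : ∀ n m, ω n ≠ -conj (ζ m))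
    (γ α χ μ ν M : ℝ) (n' : ℕ)
    (hγ : 0 < γ) (hα : 0 < α) (hχ : χ < 0) (hμ : 0 < μ) (hν : 1 / 2 < ν) (hM : 0 < M)
    (hgapω : liminf (fun n => (((ω (n + 1)).re - (ω n).re : ℝ) : EReal)) atTop = (γ : EReal))
    (hgapζ : liminf (fun n => (((ζ (n + 1)).re - (ζ n).re : ℝ) : EReal)) atTop = (γ : EReal))
    (hωim : Tendsto (fun n => (ω n).im) atTop (𝓝 α))
    (hrlim : Tendsto r atTop (𝓝 χ))
    (hζim : Tendsto (fun n => (ζ n).im) atTop (𝓝 0))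
    (hd : Comparable (fun n => ‖d n‖) (fun n => ‖ζ n‖))
    (hc : ∀ n, ‖c n‖ ≤ M / ‖ω n‖)
    (hγα : 4 * α < γ)
    (T : ℝ) (hT : 2 * Real.pi / Real.sqrt (γ ^ 2 - 16 * α ^ 2) < T) :
    -- the constants do not depend on the coefficients
    ∃ c₁ : ℝ, 0 < c₁ ∧ ∃ c₂ : ℝ, 0 < c₂ ∧
      ∀ (C D : ℕ → ℂ) (R : ℕ → ℝ) (E : ℝ),
        (∀ n : ℕ, n' ≤ n + 1 →
          |R n| ≤ μ / ((n : ℝ) + 1) ^ ν * Real.sqrt (‖C n‖ ^ 2 + ‖d n * D n‖ ^ 2)) →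
        (∀ n : ℕ, n + 1 ≤ n' →
          |R n| ≤ μ * Real.sqrt (‖C n‖ ^ 2 + ‖d n * D n‖ ^ 2)) →
        ‖E‖ₑ ^ 2 ≤ ENNReal.ofReal M * coeffEnergy d C D →
        (coeffEnergy d C D < ⊤ →
          ∃ u₁ u₂ : ℝ → ℂ, IsSeriesPair T η ω ζ r c d C D R E u₁ u₂) ∧
        ∀ u₁ u₂ : ℝ → ℂ, IsSeriesPair T η ω ζ r c d C D R E u₁ u₂ →
          ENNReal.ofReal c₁ * (∫⁻ t in Set.Ioo 0 T, (‖u₁ t‖ₑ ^ 2 + ‖u₂ t‖ₑ ^ 2))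
              ≤ coeffEnergy d C D ∧
            coeffEnergy d C D
              ≤ ENNReal.ofReal c₂ * (∫⁻ t in Set.Ioo 0 T, (‖u₁ t‖ₑ ^ 2 + ‖u₂ t‖ₑ ^ 2)) := by

  obtain ⟨hT0, hγT⟩ := two_pi_lt_mul_of_lt hγ hα hγα hT
  set a : ℕ → ℝ := fun n => if n' ≤ n + 1 then μ / ((n : ℝ) + 1) ^ ν else μ with ha
  obtain ⟨k₁, hk₁, k₂, hk₂, hcomp⟩ := hd
  have hωtop := ExponentialSystem.tendsto_norm_atTop hγ hgapω
  have hζtop := ExponentialSystem.tendsto_norm_atTop hγ hgapζ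
  have hd_pos : ∀ n, 0 < ‖d n‖ := fun n => by
    have h1 := (hcomp n).2
    have h2 := norm_pos_iff.2 (hζ0 n)
    exact pos_of_mul_pos_right (h2.trans_le h1) hk₂.le
  have hsys : ExponentialSystem ω ζ r a c d γ α :=
    { γ_pos := hγ
      gapω := hgapω
      gapζ := hgapζ
      imω := hωim
      imζ := hζim
      c_tendsto := tendsto_zero_of_norm_le_div hc hωtop
      d_inv_tendsto := tendsto_zero_of_norm_le_div (M := k₂) (fun n => by
        rw [norm_inv, inv_eq_one_div, div_le_div_iff₀ (hd_pos n) (norm_pos_iff.2 (hζ0 n)), one_mul]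
        exact (hcomp n).2) hζtop
      d_ne := fun n => norm_pos_iff.1 (hd_pos n)
      r_bdd := by
        obtain ⟨B, hB⟩ := (Metric.isBounded_range_of_tendsto _ hrlim).exists_norm_le
        exact ⟨B, fun n => hB _ ⟨n, rfl⟩⟩
      a_nonneg := fun n => by
        simp only [ha]
        split_ifs <;> positivity
      a_sq := summable_sq_ite_div_rpow μ hν n' }
  have hinj := exponent₁_injective hω hζ hr hωζ hrω hrζ hωω hζζ hωζ''
  -- The constant is `2M` because the bound on `ℰ` by the full energy is transferred to partial sums
  -- at the price of a factor 2.
  obtain ⟨κ, hκ, hinv⟩ := hsys.exists_inverse hinj η (2 * M) hT0 hγT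
  obtain ⟨K, hK, hdir⟩ := hsys.exists_direct η (by positivity : 0 < 2 * M) hT0
  refine ⟨K⁻¹, by positivity, κ⁻¹, by positivity, fun C D R E hR hR' hE => ?_⟩
  have hRa : ∀ n, |R n| ≤ a n * Real.sqrt (pairEnergy d C D n) := fun n => by
    simp only [ha]
    split_ifs with hn
    · exact hR n hn
    · exact hR' n (by omega)
  refine ⟨hsys.exists_isSeriesPair η hT0 E hRa, fun u₁ u₂ hu => ?_⟩
  have hen := tendsto_sum_pairEnergy d C D
  have hint := ExponentialSystem.tendsto_energy η hT0 hu
  have hEN := eventually_sq_le_partial_energy hM hE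
  constructor
  · refine le_of_tendsto_of_tendsto
      (ENNReal.Tendsto.const_mul hint (Or.inr ENNReal.ofReal_ne_top)) hen ?_
    filter_upwards [hEN] with N hN
    rw [← ENNReal.ofReal_mul (by positivity)]
    refine ENNReal.ofReal_le_ofReal ?_
    rw [inv_mul_le_iff₀ hK]
    exact hdir N C D R E hRa hN
  · refine le_of_tendsto_of_tendsto hen
      (ENNReal.Tendsto.const_mul hint (Or.inr ENNReal.ofReal_ne_top)) ?_
    filter_upwards [hEN] with N hN
    rw [← ENNReal.ofReal_mul (by positivity)]
    refine ENNReal.ofReal_le_ofReal ?_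
    rw [le_inv_mul_iff₀ hκ]
    exact hinv N C D R E hRa hN
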